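/- Let $\Omega=\{(a,b)\in\mathbb{R}^2 : a,b\in(0,1],\ a+b>1\}$, let $k(a,b)=\lfloor (1+a)/b\rfloor$ on $\Omega$, and let $T:\Omega\to\Omega$ be the BCZ map $T(a,b)=(b,\,-a+k(a,b)\,b)$. For $(a,b)\in\Omega$ and $n\ge 1$ put $k_n(a,b)=k(T^{n-1}(a,b))$ and $f_n=\sum_{i=1}^{n}\bigl(k_i(a,b)-3\bigr)$. For an irrational real number $s$ define its even and odd Diophantine exponents in $[2,\infty]$ by $$e^+(s)=\sup\Bigl\{v\in\mathbb{R}: 0<\tfrac pq-s<\tfrac1{q^v}\text{ for infinitely many }\tfrac pq\in\mathbb{Q}\Bigr\},$$ $$e^-(s)=\sup\Bigl\{v\in\mathbb{R}: 0<s-\tfrac pq<\tfrac1{q^v}\text{ for infinitely many }\tfrac pq\in\mathbb{Q}\Bigr\},$$ where $p/q$ is in lowest terms with $q\geq 1$. Theorem. Let $(a,b)\in\Omega$ with $b/a$ irrational, and let $e^\pm=e^\pm(b/a)$. Then $$\limsup_{n\to\infty}\frac{\log|f_n|}{\log n}=\max\left\{\frac{e^--1}{e^-},\ \frac{e^+-2}{e^+}\right\},$$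 where $\log 0=-\infty$, and where a quotient $\frac{e^--1}{e^-}$ or $\frac{e^+-2}{e^+}$ is read as $1$ if its exponent is $\infty$. -/

import Mathlib

open Filter

noncomputable section

namespace BCZ

/-- The Farey (BCZ) triangle `Ω = {(a, b) : a, b ∈ (0, 1], a + b > 1}`. -/
def fareyTriangle : Set (ℝ × ℝ) :=
  {x | x.1 ∈ Set.Ioc (0 : ℝ) 1 ∧ x.2 ∈ Set.Ioc (0 : ℝ) 1 ∧ 1 < x.1 + x.2}

/-- The itinerary (index) function `k(a, b) = [(1 + a) / b]`. -/
def index (x : ℝ × ℝ) : ℤ := ⌊(1 + x.1) / x.2⌋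

/-- The BCZ map `T(a, b) = (b, -a + [(1 + a) / b] b)`. -/
def bczMap (x : ℝ × ℝ) : ℝ × ℝ := (x.2, -x.1 + (index x : ℝ) * x.2)

/-- The BCZ map sends the Farey triangle to itself. -/
theorem bczMap_mapsTo : Set.MapsTo bczMap fareyTriangle fareyTriangle := by
  rintro ⟨a, b⟩ ⟨_, ⟨hb0, hb1⟩, _⟩
  simp only at hb0 hb1
  have h1 : ((⌊(1 + a) / b⌋ : ℤ) : ℝ) * b ≤ 1 + a :=
    (le_div_iff₀ hb0).1 (Int.floor_le _)
  have h2 : 1 + a < ((⌊(1 + a) / b⌋ : ℤ) + 1 : ℝ) * b :=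
    (div_lt_iff₀ hb0).1 (Int.lt_floor_add_one _)
  simp only [fareyTriangle, bczMap, index, Set.mem_ofPred_eq, Set.mem_Ioc]
  exact ⟨⟨hb0, hb1⟩, ⟨by linarith, by linarith⟩, by linarith⟩

/-- The forward itinerary `k_n(a, b) = k(T^(n-1)(a, b))`, used for `n ≥ 1` only. -/
def itinerary (x : ℝ × ℝ) (n : ℕ) : ℤ := index (bczMap^[n - 1] x)

/-- The forward partial sum `f_n = ∑_{i=1}^n (k_i(a, b) - 3)`. -/
def partialSum (x : ℝ × ℝ) (n : ℕ) : ℤ := ∑ i ∈ Finset.Icc 1 n, (itinerary x i - 3)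

/-- The even Diophantine exponent
`e⁺(s) = sup {v ∈ ℝ : 0 < p/q - s < 1/q^v for infinitely many p/q ∈ ℚ}`,
with the supremum taken in the extended reals; `q` is the reduced denominator of `p/q`. -/
def evenExponent (s : ℝ) : EReal :=
  ⨆ v ∈ {v : ℝ | {r : ℚ | 0 < (r : ℝ) - s ∧ (r : ℝ) - s < 1 / (r.den : ℝ) ^ v}.Infinite},
    (v : EReal)

/-- The odd Diophantine exponent
`e⁻(s) = sup {v ∈ ℝ : 0 < s - p/q < 1/q^v for infinitely many p/q ∈ ℚ}`,
with the supremum taken in the extended reals; `q` is the reduced denominator of `p/q`. -/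
def oddExponent (s : ℝ) : EReal :=
  ⨆ v ∈ {v : ℝ | {r : ℚ | 0 < s - (r : ℝ) ∧ s - (r : ℝ) < 1 / (r.den : ℝ) ^ v}.Infinite},
    (v : EReal)

/-- The quotient `(e - c) / e`, with its limiting value `1` at `e = ∞`. -/
def exponentRatio (c : ℝ) (e : EReal) : EReal := if e = ⊤ then 1 else (e - (c : EReal)) / e

/-- `log |m| / log n` as an extended real, equal to `-∞` when `m = 0`. -/
def logSpeed (m : ℤ) (n : ℕ) : EReal :=
  if m = 0 then ⊥ else ((Real.log |(m : ℝ)| / Real.log (n : ℝ) : ℝ) : EReal)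

end BCZ

end

/-! Write a_n for the first coordinate of T^n(a, b). It is the width q_n b - p_n a of an integer
vector v_n = (q_n, p_n). Consecutive vectors have determinant 1, the slopes q_n / a_n increase, and
the orbit meets every primitive vector with q > 0 and width in (0, 1] (`exists_vec_eq`). Slopes grow
linearly in n (`mul_le_slope`, `exists_slope_le`), so a vector of width X and first entry q is met
at a time comparable to q / X.

The sum f_n is read from a word: the pair (v_{n+1}, v_{n+2}) is produced from the standard basis by
the two elementary additions, and f_{n+1} + 3 is the number of `true` minus the number of `false`
(`exists_word`).

Upper bound. The entries of the pair are O(n), so the word has O(log n) runs (`abs_balance_le`).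
Apart from runs of bounded length, a run of length N exhibits a vector of positive width O(1 / N),
or a vector of negative width -ε with N q ε ≤ 1. The exponents limit how early such vectors can
matter, which gives N = O(n^θ) (`run_bound`).

Lower bound. A vector of small width X > 0 makes one index about 1 / X, at a time at most of order q
/ X; with X about q^(1-v) this is the exponent (v - 1) / v. For a vector w of width -ε < 0 with
lower neighbour u, the sum drops by about m between the visits to u and u + m w, where m can be of
order 1 / (q ε) and the time is at most of order m q^2; with ε about q^(1-v) this is the exponent (v
- 2) / v. -/

namespace BCZ

/-! ### Orbit coordinates and the integer vectors behind them -/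

/-- The first coordinate of the `n`-th point of the BCZ orbit. -/
noncomputable def coord (x : ℝ × ℝ) (n : ℕ) : ℝ := (bczMap^[n] x).1

/-- The index of the `n`-th point of the BCZ orbit. -/
noncomputable def ind (x : ℝ × ℝ) (n : ℕ) : ℤ := index (bczMap^[n] x)

theorem coord_zero (x : ℝ × ℝ) : coord x 0 = x.1 := rfl

theorem coord_succ (x : ℝ × ℝ) (n : ℕ) : coord x (n + 1) = (bczMap^[n] x).2 := by
  simp only [coord, Function.iterate_succ_apply', bczMap]

theorem coord_one (x : ℝ × ℝ) : coord x 1 = x.2 := rfl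

theorem coord_rec (x : ℝ × ℝ) (n : ℕ) :
    coord x (n + 2) = (ind x n : ℝ) * coord x (n + 1) - coord x n := by
  rw [coord_succ x (n + 1), Function.iterate_succ_apply', coord_succ x n]
  simp only [coord, bczMap, ind]
  ring

theorem iterate_mem {x : ℝ × ℝ} (hx : x ∈ fareyTriangle) (n : ℕ) :
    bczMap^[n] x ∈ fareyTriangle := bczMap_mapsTo.iterate n hx

theorem coord_pos {x : ℝ × ℝ} (hx : x ∈ fareyTriangle) (n : ℕ) : 0 < coord x n :=
  (iterate_mem hx n).1.1

theorem coord_le_one {x : ℝ × ℝ} (hx : x ∈ fareyTriangle) (n : ℕ) : coord x n ≤ 1 :=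
  (iterate_mem hx n).1.2

theorem one_lt_coord_add {x : ℝ × ℝ} (hx : x ∈ fareyTriangle) (n : ℕ) :
    1 < coord x n + coord x (n + 1) := by
  rw [coord_succ]; exact (iterate_mem hx n).2.2

theorem ind_iterate (x : ℝ × ℝ) (i n : ℕ) : ind (bczMap^[i] x) n = ind x (n + i) := by
  simp only [ind, Function.iterate_add_apply]

theorem partialSum_eq (x : ℝ × ℝ) (n : ℕ) :
    partialSum x n = ∑ i ∈ Finset.range n, (ind x i - 3) := by
  induction n with
  | zero => simp [partialSum]
  | succ n ih =>
    rw [Finset.sum_range_succ, ← ih, partialSum, Finset.sum_Icc_succ_top (by omega)]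
    rfl

theorem partialSum_succ (x : ℝ × ℝ) (n : ℕ) :
    partialSum x (n + 1) = partialSum x n + (ind x n - 3) := by
  rw [partialSum_eq, partialSum_eq, Finset.sum_range_succ]

theorem partialSum_iterate (x : ℝ × ℝ) (i n : ℕ) :
    partialSum (bczMap^[i] x) n = partialSum x (n + i) - partialSum x i := by
  induction n with
  | zero => simp [partialSum_eq]
  | succ n ih =>
    rw [partialSum_succ, ih, ind_iterate, Nat.add_right_comm, partialSum_succ]; ring

/-- The index is determined by `k a_{n+1} ≤ 1 + a_n < (k + 1) a_{n+1}`. -/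
theorem lt_ind_add_one_mul {x : ℝ × ℝ} (hx : x ∈ fareyTriangle) (n : ℕ) :
    1 + coord x n < ((ind x n : ℝ) + 1) * coord x (n + 1) := by
  have h := one_lt_coord_add hx (n + 1)
  have h2 := coord_rec x n
  linarith

/-- The integer vectors `(q, p)` that accompany the orbit: `a_n = q b - p a`. -/
noncomputable def vec (x : ℝ × ℝ) : ℕ → ℤ × ℤ
  | 0 => (0, -1)
  | 1 => (1, 0)
  | n + 2 => ind x n • vec x (n + 1) - vec x n

/-- The linear form `(q, p) ↦ q b - p a`. -/
def width (x : ℝ × ℝ) (z : ℤ × ℤ) : ℝ := x.2 * z.1 - x.1 * z.2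

/-- The determinant of two integer vectors. -/
def cross (z w : ℤ × ℤ) : ℤ := z.1 * w.2 - z.2 * w.1

theorem vec_zero (x : ℝ × ℝ) : vec x 0 = (0, -1) := by rw [vec]

theorem vec_one (x : ℝ × ℝ) : vec x 1 = (1, 0) := by rw [vec]

theorem vec_rec (x : ℝ × ℝ) (n : ℕ) : vec x (n + 2) = ind x n • vec x (n + 1) - vec x n := by
  rw [vec]

theorem vec_rec_fst (x : ℝ × ℝ) (n : ℕ) :
    (vec x (n + 2)).1 = ind x n * (vec x (n + 1)).1 - (vec x n).1 := by
  rw [vec_rec]; simp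

theorem vec_rec_snd (x : ℝ × ℝ) (n : ℕ) :
    (vec x (n + 2)).2 = ind x n * (vec x (n + 1)).2 - (vec x n).2 := by
  rw [vec_rec]; simp

theorem width_mul_sub (x : ℝ × ℝ) (z w : ℤ × ℤ) :
    width x z * w.1 - width x w * z.1 = x.1 * (cross z w : ℤ) := by
  simp only [width, cross]; push_cast; ring

theorem width_add (x : ℝ × ℝ) (z w : ℤ × ℤ) : width x (z + w) = width x z + width x w := by
  simp only [width, Prod.fst_add, Prod.snd_add]; push_cast; ring

theorem width_nsmul (x : ℝ × ℝ) (m : ℕ) (z : ℤ × ℤ) : width x (m • z) = m * width x z := by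
  simp only [width, Prod.smul_fst, Prod.smul_snd]; push_cast [nsmul_eq_mul]; ring

theorem cross_vec_succ (x : ℝ × ℝ) (n : ℕ) : cross (vec x n) (vec x (n + 1)) = 1 := by
  induction n with
  | zero => simp [vec_zero, vec_one, cross]
  | succ n ih =>
    simp only [cross] at ih ⊢
    rw [vec_rec_fst, vec_rec_snd]; linarith

theorem coord_eq_width (x : ℝ × ℝ) (n : ℕ) : coord x n = width x (vec x n) := by
  induction n using Nat.twoStepInduction with
  | zero => simp [coord_zero, width, vec_zero]
  | one => simp [coord_one, width, vec_one]
  | more n h0 h1 =>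
    rw [coord_rec, h0, h1]
    simp only [width, vec_rec_fst, vec_rec_snd]; push_cast; ring

theorem coord_mul_vec_fst_sub (x : ℝ × ℝ) (n : ℕ) :
    coord x n * (vec x (n + 1)).1 - coord x (n + 1) * (vec x n).1 = x.1 := by
  rw [coord_eq_width, coord_eq_width, width_mul_sub, cross_vec_succ]; simp

theorem coord_mul_vec_snd_sub (x : ℝ × ℝ) (n : ℕ) :
    coord x n * (vec x (n + 1)).2 - coord x (n + 1) * (vec x n).2 = x.2 := by
  have h := cross_vec_succ x n
  have h' : ((vec x n).1 * (vec x (n + 1)).2 - (vec x n).2 * (vec x (n + 1)).1 : ℝ) = 1 := by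
    exact_mod_cast h
  rw [coord_eq_width, coord_eq_width, width, width]
  linear_combination x.2 * h'

section Triangle

variable {x : ℝ × ℝ} (hx : x ∈ fareyTriangle)
include hx

theorem vec_fst_pos (n : ℕ) : 0 < (vec x (n + 1)).1 := by
  induction n with
  | zero => simp [vec_one]
  | succ n ih =>
    have h := coord_mul_vec_fst_sub x (n + 1)
    have h1 : (0 : ℝ) < coord x (n + 2) * (vec x (n + 1)).1 :=
      mul_pos (coord_pos hx _) (by exact_mod_cast ih)
    have h2 : (0 : ℝ) < coord x (n + 1) * (vec x (n + 2)).1 := by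
      have := hx.1.1
      linarith
    exact_mod_cast (pos_iff_pos_of_mul_pos h2).1 (coord_pos hx _)

theorem vec_fst_nonneg (n : ℕ) : 0 ≤ (vec x n).1 := by
  cases n with
  | zero => simp [vec_zero]
  | succ n => exact (vec_fst_pos hx n).le

theorem vec_snd_pos (n : ℕ) : 0 < (vec x (n + 2)).2 := by
  have key : ∀ m, 0 ≤ (vec x (m + 1)).2 → 0 < (vec x (m + 2)).2 := by
    intro m hm
    have h := coord_mul_vec_snd_sub x (m + 1)
    have h1 : (0 : ℝ) ≤ coord x (m + 2) * (vec x (m + 1)).2 :=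
      mul_nonneg (coord_pos hx _).le (by exact_mod_cast hm)
    have h2 : (0 : ℝ) < coord x (m + 1) * (vec x (m + 2)).2 := by
      have := hx.2.1.1
      linarith
    exact_mod_cast (pos_iff_pos_of_mul_pos h2).1 (coord_pos hx _)
  induction n with
  | zero => exact key 0 (by simp [vec_one])
  | succ n ih => exact key _ ih.le

theorem vec_snd_nonneg (n : ℕ) : 0 ≤ (vec x (n + 1)).2 := by
  cases n with
  | zero => simp [vec_one]
  | succ n => exact (vec_snd_pos hx n).le

theorem ind_pos (n : ℕ) : 0 < ind x n := by
  have h := lt_ind_add_one_mul hx n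
  have h1 := coord_pos hx n
  have h2 := coord_le_one hx (n + 1)
  have h3 := coord_pos hx (n + 1)
  by_contra! hc
  have : (ind x n : ℝ) ≤ 0 := by exact_mod_cast hc
  nlinarith

end Triangle

/-- Restarting the orbit at time i amounts to a change of lattice basis: the vectors of the new
orbit are the coordinates of the old ones in the basis (v_{i+1}, -v_i). Both sides satisfy the same
recurrence in n. -/
theorem vec_add (x : ℝ × ℝ) (i n : ℕ) :
    vec x (n + i) = (vec (bczMap^[i] x) n).1 • vec x (i + 1)
      - (vec (bczMap^[i] x) n).2 • vec x i := by
  induction n using Nat.twoStepInduction with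
  | zero => simp [vec_zero]
  | one => simp [vec_one, add_comm]
  | more n h0 h1 =>
    rw [show n + 2 + i = n + i + 2 by ring, vec_rec x (n + i), h0,
      show n + i + 1 = n + 1 + i by ring, h1, vec_rec_fst, vec_rec_snd, ind_iterate]
    ext <;> simp <;> ring

theorem vec_iterate_fst (x : ℝ × ℝ) (i n : ℕ) :
    (vec (bczMap^[i] x) n).1 = cross (vec x i) (vec x (n + i)) := by
  have h := cross_vec_succ x i
  rw [vec_add x i n]
  simp only [cross, Prod.fst_sub, Prod.snd_sub, Prod.smul_fst, Prod.smul_snd, smul_eq_mul] at h ⊢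
  linear_combination -(vec (bczMap^[i] x) n).1 * h

theorem vec_iterate_snd (x : ℝ × ℝ) (i n : ℕ) :
    (vec (bczMap^[i] x) n).2 = cross (vec x (i + 1)) (vec x (n + i)) := by
  have h := cross_vec_succ x i
  rw [vec_add x i n]
  simp only [cross, Prod.fst_sub, Prod.snd_sub, Prod.smul_fst, Prod.smul_snd, smul_eq_mul] at h ⊢
  linear_combination -(vec (bczMap^[i] x) n).2 * h

theorem width_iterate (x : ℝ × ℝ) (i : ℕ) (w : ℤ × ℤ) :
    width (bczMap^[i] x) (cross (vec x i) w, cross (vec x (i + 1)) w) = width x w := by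
  have h : ((vec x i).1 * (vec x (i + 1)).2 - (vec x i).2 * (vec x (i + 1)).1 : ℝ) = 1 := by
    exact_mod_cast cross_vec_succ x i
  have h1 : (bczMap^[i] x).1 = width x (vec x i) := coord_eq_width x i
  have h2 : (bczMap^[i] x).2 = width x (vec x (i + 1)) := by
    rw [← coord_eq_width, coord_succ]
  rw [width, h1, h2]
  simp only [width, cross]
  push_cast
  linear_combination (x.2 * w.1 - x.1 * w.2) * h

/-! ### Slopes, and the orbit as an enumeration of primitive vectors -/

/-- The slope `q_n / a_n` of the `n`-th vector. -/
noncomputable def slope (x : ℝ × ℝ) (n : ℕ) : ℝ := (vec x n).1 / coord x n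

section Slope

variable {x : ℝ × ℝ} (hx : x ∈ fareyTriangle)
include hx

theorem slope_succ_sub (n : ℕ) :
    slope x (n + 1) - slope x n = x.1 / (coord x n * coord x (n + 1)) := by
  have h0 := (coord_pos hx n).ne'
  have h1 := (coord_pos hx (n + 1)).ne'
  rw [slope, slope, ← coord_mul_vec_fst_sub x n]
  field_simp

theorem mul_le_slope (n : ℕ) : x.1 * n ≤ slope x n := by
  induction n with
  | zero => simp [slope, vec_zero]
  | succ n ih =>
    have h := slope_succ_sub hx n
    have h0 := coord_pos hx n
    have h1 := coord_pos hx (n + 1)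
    have h2 := coord_le_one hx n
    have h3 := coord_le_one hx (n + 1)
    have h4 : x.1 ≤ x.1 / (coord x n * coord x (n + 1)) := by
      rw [le_div_iff₀ (by positivity)]
      have : coord x n * coord x (n + 1) ≤ 1 := mul_le_one₀ h2 h1.le h3
      nlinarith [hx.1.1]
    push_cast; linarith

theorem slope_mono : Monotone (slope x) := by
  refine monotone_nat_of_le_succ fun n => ?_
  have h := slope_succ_sub hx n
  have : 0 < x.1 / (coord x n * coord x (n + 1)) :=
    div_pos hx.1.1 (mul_pos (coord_pos hx n) (coord_pos hx _))
  linarith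

theorem one_le_slope (n : ℕ) : 1 ≤ slope x (n + 1) := by
  refine le_trans ?_ (slope_mono hx (Nat.le_add_left 1 n))
  rw [slope, vec_one, coord_one]
  simpa using (one_le_inv₀ hx.2.1.1).2 hx.2.1.2

theorem vec_fst_le_slope (n : ℕ) : ((vec x n).1 : ℝ) ≤ slope x n := by
  rw [slope, le_div_iff₀ (coord_pos hx n)]
  have : (0 : ℝ) ≤ (vec x n).1 := by exact_mod_cast vec_fst_nonneg hx n
  nlinarith [coord_le_one hx n]

/-- Every primitive integer vector of width in `(0, 1]` occurs along the orbit. -/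
theorem exists_vec_eq {z : ℤ × ℤ} (hz : IsCoprime z.1 z.2) (hz1 : 0 < z.1)
    (hw : 0 < width x z) (hw1 : width x z ≤ 1) : ∃ n, vec x (n + 1) = z := by
  have ha := hx.1.1
  have hz1' : (0 : ℝ) < z.1 := by exact_mod_cast hz1
  -- The sign of the determinant compares slopes, and the slopes of the orbit are unbounded, so some
  -- v_n has larger slope than z. The first such n brackets z between two consecutive vectors.
  have hex : ∃ n, cross (vec x n) z < 0 := by
    obtain ⟨n, hn⟩ := exists_nat_gt (z.1 / width x z / x.1)
    refine ⟨n, ?_⟩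
    have h1 : z.1 / width x z < slope x n :=
      lt_of_lt_of_le (by rw [div_lt_iff₀ ha] at hn; linarith) (mul_le_slope hx n)
    rw [slope, div_lt_div_iff₀ hw (coord_pos hx n), coord_eq_width] at h1
    have h2 := width_mul_sub x (vec x n) z
    have h3 : x.1 * (cross (vec x n) z : ℤ) < 0 := by linarith
    have h4 : ((cross (vec x n) z : ℤ) : ℝ) < 0 := by
      by_contra! hc
      nlinarith
    exact_mod_cast h4
  classical
  obtain ⟨hN, hmin⟩ := And.intro (Nat.find_spec hex) fun m => Nat.find_min hex (m := m)
  generalize Nat.find hex = N at hN hmin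
  obtain _ | N := N
  · simp [vec_zero, cross] at hN
    omega
  have hb := hmin N (Nat.lt_succ_self N)
  push Not at hb
  have hc := cross_vec_succ x N
  have e1 : z.1 = -cross (vec x (N + 1)) z * (vec x N).1 + cross (vec x N) z * (vec x (N + 1)).1 := by
    simp only [cross] at hc ⊢
    linear_combination -z.1 * hc
  have e2 : z.2 = -cross (vec x (N + 1)) z * (vec x N).2 + cross (vec x N) z * (vec x (N + 1)).2 := by
    simp only [cross] at hc ⊢
    linear_combination -z.2 * hc
  generalize cross (vec x N) z = β at *
  generalize cross (vec x (N + 1)) z = α at *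
  have hwz : width x z = -α * coord x N + β * coord x (N + 1) := by
    have e1' : (z.1 : ℝ) = -α * (vec x N).1 + β * (vec x (N + 1)).1 := by exact_mod_cast e1
    have e2' : (z.2 : ℝ) = -α * (vec x N).2 + β * (vec x (N + 1)).2 := by exact_mod_cast e2
    rw [coord_eq_width, coord_eq_width, width, width, width, e1', e2']
    ring
  -- With both coefficients at least 1, the width of z would be at least a_N + a_{N+1} > 1.
  have hb0 : β = 0 := by
    by_contra hne
    have h1 : (1 : ℝ) ≤ β := by exact_mod_cast (show 1 ≤ β by omega)
    have h2 : (1 : ℝ) ≤ -α := by exact_mod_cast (show 1 ≤ -α by omega)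
    have := one_lt_coord_add hx N
    nlinarith [coord_pos hx N, coord_pos hx (N + 1)]
  subst hb0
  have hu : IsUnit (-α) := hz.isUnit_of_dvd' ⟨(vec x N).1, by linarith⟩ ⟨(vec x N).2, by linarith⟩
  have hα : -α = 1 := by
    rcases Int.isUnit_iff.1 hu with h | h <;> omega
  rw [hα] at e1 e2
  obtain _ | N := N
  · simp [vec_zero] at e1; omega
  · exact ⟨N, by ext <;> simp [e1, e2]⟩

end Slope

/-! ### Linear upper bound for the slopes -/

section Growth

variable {x : ℝ × ℝ} (hx : x ∈ fareyTriangle)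
include hx

/-- Before reaching a small coordinate `ε`, the orbit goes through an arithmetic progression of
step `-ε`. -/
theorem coord_run (m j : ℕ) (hm : (2 * m + 1) * coord x (j + m + 1) ≤ 1) :
    coord x j = coord x (j + m) - m * coord x (j + m + 1) ∧
      ∃ J : ℤ, coord x (j + 1) = J * coord x j + coord x (j + m + 1) := by
  induction m generalizing j with
  | zero => exact ⟨by simp, 0, by simp⟩
  | succ m ih =>
    rw [show j + (m + 1) + 1 = j + 1 + m + 1 by ring, show j + (m + 1) = j + 1 + m by ring] at *
    have hpos := coord_pos hx (j + 1 + m + 1)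
    push_cast at hm ⊢
    obtain ⟨h1, J, hJ⟩ := ih (j + 1) (by nlinarith)
    have hr := coord_rec x j
    have hadd := one_lt_coord_add hx (j + 1 + m)
    have hj := coord_le_one hx j
    have hjs := one_lt_coord_add hx j
    have hk := coord_le_one hx (j + 1)
    have hkp := coord_pos hx (j + 1)
    set ε := coord x (j + 1 + m + 1)
    -- The congruence a_{j+2} ≡ ε modulo a_{j+1}, carried by J, combines with the recurrence to give
    -- a_j ≡ -ε modulo a_{j+1}. The size bounds then leave only a_j = a_{j+1} - ε.
    have h2 : coord x j - (coord x (j + 1) - ε) = ((ind x j - J - 1 : ℤ) : ℝ) * coord x (j + 1) := by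
      push_cast; rw [show j + 1 + 1 = j + 2 by ring] at hJ; linarith
    have h3 : ind x j - J - 1 = 0 := by
      have hlt : ((ind x j - J - 1 : ℤ) : ℝ) < 1 := by
        by_contra! hc
        nlinarith
      have hgt : (-1 : ℝ) < ((ind x j - J - 1 : ℤ) : ℝ) := by
        by_contra! hc
        nlinarith
      have hlt' : ind x j - J - 1 < 1 := by exact_mod_cast hlt
      have hgt' : -1 < ind x j - J - 1 := by exact_mod_cast hgt
      omega
    rw [h3] at h2
    push_cast at h2
    exact ⟨by linarith, 1, by push_cast; linarith⟩

/-- Small coordinates are rare: a coordinate ε < 1/3 is preceded by about 1 / (2ε) coordinates that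
are at least 1/3, and 1 / ε is charged to that block. The constant pays for a block cut short by the
start of the orbit. -/
theorem sum_inv_coord_le (hne : x.1 ≠ x.2) (n : ℕ) :
    ∑ i ∈ Finset.range n, (coord x i)⁻¹ ≤ (x.1⁻¹ + x.2⁻¹ + |x.2 - x.1|⁻¹) + 6 * n := by
  have ha := inv_pos.2 hx.1.1
  have hb := inv_pos.2 hx.2.1.1
  have hab := inv_pos.2 (abs_pos.2 (sub_ne_zero.2 hne.symm))
  induction n using Nat.strong_induction_on with
  | _ n ih =>
  obtain _ | n := n
  · simp; positivity
  have hε := coord_pos hx n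
  rw [Finset.sum_range_succ]
  rcases le_or_gt (1 / 3) (coord x n) with h3 | h3
  · have h1 := ih n (Nat.lt_succ_self n)
    have : (coord x n)⁻¹ ≤ 3 := by
      rw [inv_le_comm₀ hε (by norm_num)]; linarith
    push_cast; linarith
  have hlarge : ∀ m j : ℕ, j + m + 1 = n → (2 * m + 1) * coord x n ≤ 1 →
      (coord x j)⁻¹ ≤ 3 := by
    rintro m j rfl hm
    obtain ⟨h1, -⟩ := coord_run hx m j hm
    have h2 := one_lt_coord_add hx (j + m)
    rw [inv_le_comm₀ (coord_pos hx j) (by norm_num)]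
    nlinarith
  -- The largest m for which `coord_run` applies; maximality gives 1 / ε < 2m + 3.
  obtain ⟨m, hm1, hm2⟩ : ∃ m : ℕ, (2 * m + 1) * coord x n ≤ 1 ∧ 1 < (2 * m + 3) * coord x n := by
    refine ⟨⌊((coord x n)⁻¹ - 1) / 2⌋₊, ?_, ?_⟩
    · have := Nat.floor_le (a := ((coord x n)⁻¹ - 1) / 2) (by
        have := (one_le_inv₀ hε).2 (coord_le_one hx n)
        linarith)
      have h : (2 * (⌊((coord x n)⁻¹ - 1) / 2⌋₊ : ℝ) + 1) ≤ (coord x n)⁻¹ := by linarith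
      calc _ ≤ (coord x n)⁻¹ * coord x n := by gcongr
        _ = 1 := inv_mul_cancel₀ hε.ne'
    · have := Nat.lt_floor_add_one (((coord x n)⁻¹ - 1) / 2)
      have h : (coord x n)⁻¹ < (2 * (⌊((coord x n)⁻¹ - 1) / 2⌋₊ : ℝ) + 3) := by linarith
      calc 1 = (coord x n)⁻¹ * coord x n := (inv_mul_cancel₀ hε.ne').symm
        _ < _ := by gcongr
  have hinv : (coord x n)⁻¹ ≤ 2 * m + 3 := by
    rw [inv_le_iff_one_le_mul₀ hε]; linarith
  have hrun : ∀ j m' : ℕ, m' ≤ m → j + m' + 1 = n → (coord x j)⁻¹ ≤ 3 := by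
    intro j m' hm' hj
    refine hlarge m' j hj (le_trans ?_ hm1)
    have : (m' : ℝ) ≤ m := by exact_mod_cast hm'
    gcongr
  rcases le_or_gt (m + 1) n with hmn | hmn
  · obtain ⟨l, rfl⟩ := Nat.exists_eq_add_of_le' hmn
    have h1 := ih l (by omega)
    rw [Finset.sum_range_add]
    have h2 : ∑ i ∈ Finset.range (m + 1), (coord x (l + i))⁻¹ ≤ (m + 1 : ℕ) • (3 : ℝ) := by
      refine (Finset.sum_le_card_nsmul _ _ 3 fun i hi => ?_).trans_eq (by simp)
      have := Finset.mem_range.1 hi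
      exact hrun (l + i) (m - i) (by omega) (by omega)
    simp only [nsmul_eq_mul] at h2
    push_cast at h2 ⊢
    linarith
  · have h2 : ∑ i ∈ Finset.range n, (coord x i)⁻¹ ≤ n • (3 : ℝ) := by
      refine (Finset.sum_le_card_nsmul _ _ 3 fun i hi => ?_).trans_eq (by simp)
      have := Finset.mem_range.1 hi
      exact hrun i (n - 1 - i) (by omega) (by omega)
    simp only [nsmul_eq_mul] at h2
    -- The progression reaches back to the start, so ε is one of the first two coordinates or their
    -- difference b - a.
    have h4 : (coord x n)⁻¹ ≤ x.1⁻¹ + x.2⁻¹ + |x.2 - x.1|⁻¹ := by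
      obtain _ | _ | n := n
      · rw [coord_zero]; linarith
      · rw [coord_one]; linarith
      · have hrm : (2 * (n + 1 : ℕ) + 1) * coord x (0 + (n + 1) + 1) ≤ 1 := by
          rw [show 0 + (n + 1) + 1 = n + 1 + 1 by ring]
          refine le_trans ?_ hm1
          have : ((n + 1 : ℕ) : ℝ) ≤ m := by exact_mod_cast (by omega)
          gcongr
        obtain ⟨h5, -⟩ := coord_run hx (n + 1) 0 hrm
        have hrm' : (2 * (n : ℝ) + 1) * coord x (1 + n + 1) ≤ 1 := by
          rw [show 0 + (n + 1) + 1 = 1 + n + 1 by ring] at hrm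
          refine le_trans ?_ hrm
          have := coord_pos hx (1 + n + 1)
          gcongr
          simp
        obtain ⟨h6, -⟩ := coord_run hx n 1 hrm'
        rw [show 0 + (n + 1) = n + 1 by ring] at h5
        rw [show 1 + n = n + 1 by ring] at h6
        rw [coord_zero] at h5
        rw [coord_one] at h6
        have h7 : x.2 - x.1 = coord x (n + 1 + 1) := by push_cast at h5; linarith
        rw [h7, abs_of_pos hε]
        linarith
    push_cast
    have : (0 : ℝ) ≤ n := n.cast_nonneg
    linarith

theorem exists_slope_le (hne : x.1 ≠ x.2) :
    ∃ C : ℝ, 0 < C ∧ ∀ n : ℕ, slope x n ≤ C * (n + 1) := by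
  have hs : ∀ n, slope x n ≤ 4 * ∑ i ∈ Finset.range (n + 1), (coord x i)⁻¹ - 2 * (coord x n)⁻¹ := by
    intro n
    induction n with
    | zero =>
      have := inv_pos.2 (coord_pos hx 0)
      simp [slope, vec_zero]; linarith
    | succ n ih =>
      rw [Finset.sum_range_succ]
      have h := slope_succ_sub hx n
      have h0 := coord_pos hx n
      have h1 := coord_pos hx (n + 1)
      -- Since a_n + a_{n+1} > 1 ≥ a, the product of inverses is controlled by their sum.
      have h2 : x.1 / (coord x n * coord x (n + 1)) ≤ 2 * (coord x n)⁻¹ + 2 * (coord x (n + 1))⁻¹ := by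
        have h3 := one_lt_coord_add hx n
        have h4 := hx.1.2
        have e : 2 * (coord x n)⁻¹ + 2 * (coord x (n + 1))⁻¹
          = 2 * (coord x n + coord x (n + 1)) / (coord x n * coord x (n + 1)) := by
          field_simp
          ring
        rw [e]
        gcongr
        linarith
      linarith
  set D := x.1⁻¹ + x.2⁻¹ + |x.2 - x.1|⁻¹ with hD
  have ha := inv_pos.2 hx.1.1
  have hb := inv_pos.2 hx.2.1.1
  have hab := inv_pos.2 (abs_pos.2 (sub_ne_zero.2 hne.symm))
  have hD0 : 0 < D := by positivity
  refine ⟨4 * D + 24, by positivity, fun n => ?_⟩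
  have h1 := sum_inv_coord_le hx hne (n + 1)
  have h2 := hs n
  have h3 := inv_pos.2 (coord_pos hx n)
  push_cast at h1
  have : (0 : ℝ) ≤ n := n.cast_nonneg
  nlinarith

end Growth

/-! ### Words of elementary additions and their balance -/

/-- The action of a word on a pair of vectors: `true` is `(u, w) ↦ (u, u + w)` and `false` is
`(u, w) ↦ (u + w, w)`. The head of the list acts last. -/
def act {G : Type*} [Add G] : List Bool → G × G → G × G
  | [], z => z
  | true :: l, z => ((act l z).1, (act l z).1 + (act l z).2)
  | false :: l, z => ((act l z).1 + (act l z).2, (act l z).2)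

/-- The number of letters `true` minus the number of letters `false`. -/
def balance (l : List Bool) : ℤ := (l.count true : ℤ) - l.count false

/-- The standard basis of `ℤ²`. -/
def stdBasis : (ℤ × ℤ) × (ℤ × ℤ) := ((1, 0), (0, 1))

theorem act_append {G : Type*} [Add G] (l l' : List Bool) (z : G × G) :
    act (l ++ l') z = act l (act l' z) := by
  induction l with
  | nil => rfl
  | cons c l ih => cases c <;> simp [act, ih]

theorem act_replicate_true {G : Type*} [AddCommMonoid G] (N : ℕ) (z : G × G) :
    act (List.replicate N true) z = (z.1, z.2 + N • z.1) := by
  induction N with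
  | zero => simp [act]
  | succ N ih =>
    rw [List.replicate_succ, act, ih, succ_nsmul]
    ext <;> simp; abel

theorem act_replicate_false {G : Type*} [AddCommMonoid G] (N : ℕ) (z : G × G) :
    act (List.replicate N false) z = (z.1 + N • z.2, z.2) := by
  induction N with
  | zero => simp [act]
  | succ N ih =>
    rw [List.replicate_succ, act, ih, succ_nsmul]
    ext <;> simp; abel

/-- The determinant relation serves to give α, δ ≥ 1: whatever letters follow a run, each vector of
the pair keeps a positive multiple of its own earlier value. -/
theorem act_eq_combination (l : List Bool) : ∃ α β γ δ : ℕ, α * δ = β * γ + 1 ∧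
    ∀ {G : Type} [AddCommMonoid G] (z : G × G),
      act l z = (α • z.1 + β • z.2, γ • z.1 + δ • z.2) := by
  induction l with
  | nil => exact ⟨1, 0, 0, 1, by simp, fun z => by simp [act]⟩
  | cons c l ih =>
    obtain ⟨α, β, γ, δ, h, hz⟩ := ih
    cases c
    · refine ⟨α + γ, β + δ, γ, δ, by linarith, fun z => ?_⟩
      rw [act, hz]
      ext <;> simp [add_smul]; abel
    · refine ⟨α, β, α + γ, β + δ, by linarith, fun z => ?_⟩
      rw [act, hz]
      ext <;> simp [add_smul]; abel

theorem balance_append (l l' : List Bool) : balance (l ++ l') = balance l + balance l' := by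
  simp only [balance, List.count_append]; push_cast; ring

theorem balance_replicate_true (N : ℕ) : balance (List.replicate N true) = N := by
  simp [balance, List.count_replicate]

theorem balance_replicate_false (N : ℕ) : balance (List.replicate N false) = -N := by
  simp [balance, List.count_replicate]

theorem exists_replicate_append (x : Bool) (l : List Bool) :
    ∃ c l', l = List.replicate c x ++ l' ∧ (l' = [] ∨ ∃ l'', l' = (!x) :: l'') := by
  induction l with
  | nil => exact ⟨0, [], by simp⟩
  | cons y l ih =>
    obtain ⟨c, l', rfl, h⟩ := ih
    by_cases hxy : y = x
    · subst hxy
      exact ⟨c + 1, l', by simp [List.replicate_succ], h⟩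
    · refine ⟨0, y :: (List.replicate c x ++ l'), by simp, Or.inr ⟨List.replicate c x ++ l', ?_⟩⟩
      rw [Bool.eq_not_of_ne hxy]

theorem act_stdBasis_nonneg (l : List Bool) :
    0 ≤ (act l stdBasis).1.1 ∧ 0 ≤ (act l stdBasis).1.2 ∧ 0 ≤ (act l stdBasis).2.1 ∧
      0 ≤ (act l stdBasis).2.2 ∧ 1 ≤ (act l stdBasis).1.1 ∧ 1 ≤ (act l stdBasis).2.2 := by
  induction l with
  | nil => simp [act, stdBasis]
  | cons c l ih => cases c <;> simp only [act, Prod.fst_add, Prod.snd_add] <;> omega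

theorem cross_act_stdBasis (l : List Bool) :
    cross (act l stdBasis).1 (act l stdBasis).2 = 1 := by
  induction l with
  | nil => simp [act, stdBasis, cross]
  | cons c l ih =>
    cases c <;> simp only [act, cross, Prod.fst_add, Prod.snd_add] at ih ⊢ <;> linarith

/-- The head letter can be read off: after `true` the second vector dominates the first entrywise,
after `false` the first dominates the second, and positivity of the diagonal entries excludes both
at once. -/
theorem act_stdBasis_injective : Function.Injective fun l => act l stdBasis := by
  intro l l' h
  simp only at h
  induction l generalizing l' with
  | nil =>
    rcases l' with _ | ⟨_ | _, l'⟩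
    · rfl
    all_goals
      have := act_stdBasis_nonneg l'
      simp only [act, stdBasis, Prod.ext_iff, Prod.fst_add, Prod.snd_add] at h this
      omega
  | cons c l ih =>
    have h1 := act_stdBasis_nonneg l
    rcases l' with _ | ⟨c', l'⟩
    · cases c <;> simp only [act, stdBasis, Prod.ext_iff, Prod.fst_add, Prod.snd_add] at h h1 <;>
        omega
    have h2 := act_stdBasis_nonneg l'
    have hc : c = c' := by
      cases c <;> cases c' <;> first | rfl | skip
      all_goals
        simp only [act, Prod.ext_iff, Prod.fst_add, Prod.snd_add] at h
        omega
    subst hc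
    rw [ih (l' := l')]
    cases c <;> simp only [act, Prod.ext_iff, Prod.fst_add, Prod.snd_add] at h ⊢ <;> omega

/-- The balance of a word is bounded by the length of its runs times the logarithm of the size of
the pair that it produces. -/
theorem abs_balance_le (B : ℝ) (e : ℕ) (l : List Bool)
    (hrun : ∀ l₁ N c l₂, l = l₁ ++ List.replicate N c ++ l₂ → (N : ℝ) ≤ B)
    (hsize : (act l stdBasis).1.1 + (act l stdBasis).1.2 + (act l stdBasis).2.1
      + (act l stdBasis).2.2 ≤ 2 ^ e) : |(balance l : ℝ)| ≤ 2 * B * e := by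
  have hB : 0 ≤ B := by simpa using hrun [] 0 true l (by simp)
  induction e generalizing l with
  | zero =>
    have := act_stdBasis_nonneg l
    simp only [pow_zero] at hsize
    omega
  | succ e ih =>
    have habs : ∀ (c : ℕ) (x : Bool), |(balance (List.replicate c x) : ℝ)| = c := by
      intro c x
      cases x <;> simp [balance_replicate_true, balance_replicate_false]
    have he : (0 : ℝ) ≤ e := e.cast_nonneg
    rcases l with _ | ⟨x, t⟩
    · simp [balance]; positivity
    obtain ⟨c, l', ht, hl'⟩ := exists_replicate_append x t
    have hl : x :: t = List.replicate (c + 1) x ++ l' := by rw [ht]; simp [List.replicate_succ]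
    generalize x :: t = l at *
    have hc := hrun [] (c + 1) x l' (by simp [hl])
    rcases hl' with rfl | ⟨t', rfl⟩
    · rw [hl, List.append_nil, habs]
      push_cast at hc ⊢
      nlinarith
    obtain ⟨c', l'', ht', -⟩ := exists_replicate_append (!x) t'
    have hl2 : (!x) :: t' = List.replicate (c' + 1) (!x) ++ l'' := by
      rw [ht']; simp [List.replicate_succ]
    rw [hl2] at hl
    have hc' := hrun (List.replicate (c + 1) x) (c' + 1) (!x) l'' (by simp [hl])
    have h0 := act_stdBasis_nonneg l''
    -- Two adjacent runs of opposite letters at least double the sum of the four entries, so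
    -- removing them lowers e by one at a cost of at most 2B in balance.
    have hrec := ih l'' (fun l₁ N y l₂ h => hrun
        (List.replicate (c + 1) x ++ List.replicate (c' + 1) (!x) ++ l₁) N y l₂
        (by rw [hl, h]; simp)) (by
      rw [hl, act_append, act_append] at hsize
      cases x <;>
      · simp only [Bool.not_true, Bool.not_false, act_replicate_true, act_replicate_false,
          Prod.fst_add, Prod.snd_add, Prod.smul_fst, Prod.smul_snd, pow_succ] at hsize
        simp only [nsmul_eq_mul] at hsize
        push_cast at hsize
        generalize act l'' stdBasis = z at *
        have hcn : (0 : ℤ) ≤ c := by positivity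
        have hcn' : (0 : ℤ) ≤ c' := by positivity
        have p1 := mul_nonneg hcn h0.1
        have p2 := mul_nonneg hcn h0.2.1
        have p3 := mul_nonneg hcn h0.2.2.1
        have p4 := mul_nonneg hcn h0.2.2.2.1
        have q1 := mul_nonneg hcn' h0.1
        have q2 := mul_nonneg hcn' h0.2.1
        have q3 := mul_nonneg hcn' h0.2.2.1
        have q4 := mul_nonneg hcn' h0.2.2.2.1
        have r1 := mul_nonneg hcn q1
        have r2 := mul_nonneg hcn q2
        have r3 := mul_nonneg hcn q3
        have r4 := mul_nonneg hcn q4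
        nlinarith)
    rw [hl, balance_append, balance_append]
    push_cast
    refine ((abs_add_le _ _).trans (add_le_add_right (abs_add_le _ _) _)).trans ?_
    rw [habs, habs]
    push_cast at hc hc' ⊢
    linarith

/-! ### Partial sums as balances of words -/

section Word

variable {x : ℝ × ℝ} (hx : x ∈ fareyTriangle)
include hx

/-- One step with index k replaces a word `false`^c `true` l₀ by `true`^(k-c-1) `false` l₀, because
(u + c(u+w), u+w) becomes (u+w, w + (k-c-1)(u+w)). The balance changes by exactly k - 3. -/
theorem exists_word (n : ℕ) : ∃ l, act l stdBasis = (vec x (n + 1), vec x (n + 2)) ∧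
    balance l = partialSum x (n + 1) + 3 := by
  induction n with
  | zero =>
    have hk := (ind_pos hx 0).le
    refine ⟨List.replicate (ind x 0).toNat true, ?_, ?_⟩
    · rw [act_replicate_true, vec_rec, vec_one, vec_zero, stdBasis]
      ext <;> simp [hk]
    · rw [balance_replicate_true, partialSum_eq]
      simp [hk]
  | succ n ih =>
    obtain ⟨l, hl, hb⟩ := ih
    obtain ⟨c, l', rfl, rfl | ⟨l₀, rfl⟩⟩ := exists_replicate_append false l
    -- A word without `true` would leave the second vector at (0, 1), whose first entry is 0.
    · have := vec_fst_pos hx (n + 1)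
      rw [List.append_nil, act_replicate_false] at hl
      have h2 : stdBasis.2 = vec x (n + 1 + 1) := congrArg Prod.snd hl
      rw [← h2] at this
      simp [stdBasis] at this
    rw [act_append, act_replicate_false] at hl
    simp only [Bool.not_false, act, Prod.ext_iff] at hl
    simp only [Prod.fst_add, Prod.snd_add, Prod.smul_fst, Prod.smul_snd] at hl
    simp only [nsmul_eq_mul] at hl
    have h0 := act_stdBasis_nonneg l₀
    have r1 := vec_rec_fst x (n + 1)
    have r2 := vec_rec_snd x (n + 1)
    have h2 := vec_snd_pos hx n
    have h3 := vec_snd_pos hx (n + 1)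
    -- If k ≤ c, the recurrence would make the second entry of v_{n+3} nonpositive.
    obtain ⟨N, hN⟩ : ∃ N : ℕ, ind x (n + 1) - c - 1 = N := by
      apply Int.eq_ofNat_of_zero_le
      by_contra! hneg
      have hle : ind x (n + 1) - c ≤ 0 := by omega
      rw [show n + 1 + 1 = n + 2 by ring, ← hl.1.2, hl.2.2] at r2
      nlinarith
    refine ⟨List.replicate N true ++ false :: l₀, ?_, ?_⟩
    · rw [act_append, act_replicate_true]
      simp only [act, Prod.ext_iff, Prod.fst_add, Prod.snd_add, Prod.smul_fst, Prod.smul_snd]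
      simp only [nsmul_eq_mul]
      have hk : ind x (n + 1) = N + c + 1 := by omega
      refine ⟨⟨hl.2.1, hl.2.2⟩, ?_, ?_⟩
      · rw [show n + 1 + 2 = n + 3 by ring, show n + 1 + 1 = n + 2 by ring] at r1
        rw [r1, hk, ← hl.1.1, ← hl.2.1]; ring
      · rw [show n + 1 + 2 = n + 3 by ring, show n + 1 + 1 = n + 2 by ring] at r2
        rw [r2, hk, ← hl.1.2, ← hl.2.2]; ring
    · have e1 : balance (true :: l₀) = balance l₀ + 1 := by simp [balance]; ring
      have e2 : balance (false :: l₀) = balance l₀ - 1 := by simp [balance]; ring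
      rw [balance_append, balance_replicate_false, Bool.not_false, e1] at hb
      rw [balance_append, balance_replicate_true, e2, partialSum_succ]
      linarith

end Word

/-! ### Diophantine lower bounds and the lengths of runs -/

/-- A lower bound for the widths of the primitive vectors of positive width. -/
def OddBound (x : ℝ × ℝ) (θ c : ℝ) : Prop :=
  ∀ z : ℤ × ℤ, IsCoprime z.1 z.2 → 0 < z.1 → 0 < width x z →
    c ≤ (z.1 : ℝ) ^ θ * width x z ^ (1 - θ)

/-- A lower bound for the widths of the primitive vectors of negative width. -/
def EvenBound (x : ℝ × ℝ) (θ c : ℝ) : Prop :=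
  ∀ z : ℤ × ℤ, IsCoprime z.1 z.2 → 0 < z.1 → width x z < 0 →
    c ≤ (z.1 : ℝ) ^ (1 + θ) * (-width x z) ^ (1 - θ)

theorem rpow_mul_rpow_one_sub {y : ℝ} (hy : 0 < y) (θ : ℝ) : y ^ θ * y ^ (1 - θ) = y := by
  rw [← Real.rpow_add hy]; simp

/-- Here q^θ X^(1-θ) = X (q / X)^θ, so `OddBound` says that 1 / X, the order of the run caused by a
width X, is O(t^θ) at slope t = q / X. Likewise `EvenBound` bounds 1 / (q X) by a multiple of (q /
X)^θ, now with X the absolute width. -/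
theorem mul_le_of_width_le {θ c q X N t : ℝ} (hθ : 0 ≤ θ) (hq : 0 < q) (hX : 0 < X)
    (hc : c ≤ q ^ θ * X ^ (1 - θ)) (hN : 0 ≤ N) (hNX : N * X ≤ 2) (ht : q / X ≤ t) :
    c * N ≤ 2 * t ^ θ := by
  have h1 : q ^ θ * X ^ (1 - θ) = (q / X) ^ θ * X := by
    have h0 : (q / X) ^ θ * X ^ θ = q ^ θ := by
      rw [← Real.mul_rpow (by positivity) hX.le, div_mul_cancel₀ _ hX.ne']
    rw [← h0, mul_assoc, rpow_mul_rpow_one_sub hX]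
  have h2 : (q / X) ^ θ ≤ t ^ θ := Real.rpow_le_rpow (by positivity) ht hθ
  have ht0 : 0 ≤ t ^ θ := le_trans (by positivity) h2
  calc c * N ≤ (q / X) ^ θ * X * N := by rw [← h1]; gcongr
    _ ≤ t ^ θ * X * N := by gcongr
    _ = t ^ θ * (N * X) := by ring
    _ ≤ t ^ θ * 2 := by gcongr
    _ = 2 * t ^ θ := by ring

theorem mul_le_of_pos_width {θ c q X N t : ℝ} (hθ : 0 ≤ θ) (hθ1 : θ ≤ 1) (hq : 0 < q) (hX : 0 < X)
    (hc : c ≤ q ^ θ * X ^ (1 - θ)) (hN : 0 < N) (hNX : N * X ≤ 1) (ht : N * q ≤ t) :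
    c * N ≤ t ^ θ := by
  calc c * N ≤ q ^ θ * X ^ (1 - θ) * N := by gcongr
    _ = q ^ θ * X ^ (1 - θ) * (N ^ θ * N ^ (1 - θ)) := by rw [rpow_mul_rpow_one_sub hN]
    _ = (N * q) ^ θ * (N * X) ^ (1 - θ) := by
      rw [Real.mul_rpow hN.le hq.le, Real.mul_rpow hN.le hX.le]; ring
    _ ≤ (N * q) ^ θ * 1 := by
      gcongr
      exact Real.rpow_le_one (by positivity) hNX (by linarith)
    _ ≤ t ^ θ := by rw [mul_one]; exact Real.rpow_le_rpow (by positivity) ht hθ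

theorem mul_le_of_neg_width {θ c q X N t : ℝ} (hθ : 0 ≤ θ) (hθ1 : θ ≤ 1) (hq : 0 < q) (hX : 0 < X)
    (hc : c ≤ q ^ (1 + θ) * X ^ (1 - θ)) (hN : 0 < N) (hNX : N * X * q ≤ 1)
    (ht : N * q ^ 2 ≤ t) : c * N ≤ t ^ θ := by
  have h1 : q ^ (1 + θ) = q ^ θ * q ^ θ * q ^ (1 - θ) := by
    rw [← Real.rpow_add hq, ← Real.rpow_add hq]; congr 1; ring
  calc c * N ≤ q ^ (1 + θ) * X ^ (1 - θ) * N := by gcongr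
    _ = q ^ (1 + θ) * X ^ (1 - θ) * (N ^ θ * N ^ (1 - θ)) := by rw [rpow_mul_rpow_one_sub hN]
    _ = (N * q ^ 2) ^ θ * (N * X * q) ^ (1 - θ) := by
      rw [Real.mul_rpow hN.le (by positivity), Real.mul_rpow (by positivity) hq.le,
        Real.mul_rpow hN.le hX.le, sq, Real.mul_rpow hq.le hq.le, h1]; ring
    _ ≤ (N * q ^ 2) ^ θ * 1 := by
      gcongr
      exact Real.rpow_le_one (by positivity) hNX (by linarith)
    _ ≤ t ^ θ := by rw [mul_one]; exact Real.rpow_le_rpow (by positivity) ht hθ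

theorem cross_isCoprime_left {u w : ℤ × ℤ} (h : cross u w = 1) : IsCoprime u.1 u.2 :=
  ⟨w.2, -w.1, by simp only [cross] at h; linarith⟩

theorem cross_isCoprime_right {u w : ℤ × ℤ} (h : cross u w = 1) : IsCoprime w.1 w.2 :=
  ⟨-u.2, u.1, by simp only [cross] at h; linarith⟩

theorem cross_comb_right (u w : ℤ × ℤ) (γ δ : ℕ) :
    cross u (γ • u + δ • w) = δ * cross u w := by
  simp only [cross, Prod.fst_add, Prod.snd_add, Prod.smul_fst, Prod.smul_snd]
  simp only [nsmul_eq_mul]; ring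

theorem cross_comb_left (u w : ℤ × ℤ) (α β : ℕ) :
    cross (α • u + β • w) w = α * cross u w := by
  simp only [cross, Prod.fst_add, Prod.snd_add, Prod.smul_fst, Prod.smul_snd]
  simp only [nsmul_eq_mul]; ring

section Run

variable {x : ℝ × ℝ} (hx : x ∈ fareyTriangle)
include hx

/-- A run of letters `true` at `(u, w)` is bounded in terms of the width of `u`. -/
theorem true_run_bound {u w r : ℤ × ℤ} {N γ δ : ℕ} (huw : cross u w = 1) (hu : 0 < u.1)
    (hw : 0 ≤ w.1) (hδ : 1 ≤ δ) (hr : r = γ • u + δ • (w + N • u)) (hr1 : 0 < r.1)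
    (hX : 0 < width x r) (hX1 : width x r ≤ 1) :
    0 < width x u ∧ N * width x u ≤ 2 ∧ u.1 / width x u ≤ r.1 / width x r := by
  have ha := hx.1.1
  have hu' : (1 : ℝ) ≤ u.1 := by exact_mod_cast hu
  have hw' : (0 : ℝ) ≤ w.1 := by exact_mod_cast hw
  have hr' : (0 : ℝ) < r.1 := by exact_mod_cast hr1
  have hδ' : (1 : ℝ) ≤ δ := by exact_mod_cast hδ
  have hcr : cross u (w + N • u) = 1 := by
    have := cross_comb_right u w N 1
    rw [one_smul, Nat.cast_one, one_mul, huw, add_comm] at this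
    exact this
  have h1 := width_mul_sub x u r
  rw [show cross u r = δ by rw [hr, cross_comb_right, hcr, mul_one]] at h1
  push_cast at h1
  have hXu : 0 < width x u := by
    have : 0 < width x u * r.1 := by nlinarith [mul_pos hX (by linarith : (0 : ℝ) < u.1)]
    exact pos_of_mul_pos_left this hr'.le
  refine ⟨hXu, ?_, ?_⟩
  · have h2 := width_mul_sub x u w
    rw [huw] at h2
    push_cast at h2
    -- Determinant 1 gives width(u) w.1 - width(w) u.1 = a ≤ 1; with u of positive width and u.1 ≥ 1
    -- this keeps width(w) above -1.
    have h3 : -1 ≤ width x w := by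
      have := hx.1.2
      by_contra! hc
      nlinarith [mul_nonneg hXu.le hw']
    have h4 : width x r = γ * width x u + δ * (width x w + N * width x u) := by
      rw [hr, width_add, width_nsmul, width_nsmul, width_add, width_nsmul]
    have h5 : (0 : ℝ) ≤ γ * width x u := by positivity
    by_contra! hc
    nlinarith
  · rw [div_le_div_iff₀ hXu hX]
    nlinarith

/-- A run of letters `false` at `(u, w)` is bounded in terms of the width of `w`. -/
theorem false_run_bound {u w p : ℤ × ℤ} {N α β : ℕ} (huw : cross u w = 1) (hu : 0 < u.1)
    (hw : 0 ≤ w.1) (hw2 : 0 < w.2) (hα : 1 ≤ α) (hp : p = α • (u + N • w) + β • w) (hu2 : 0 ≤ u.2)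
    (hX : 0 < width x p) (hX1 : width x p ≤ 1) :
    (x.1 * N ≤ 1) ∨
    (0 < w.1 ∧ 0 < width x w ∧ N * width x w ≤ 1 ∧ N * w.1 ≤ p.1 / width x p) ∨
    (0 < w.1 ∧ width x w = 0) ∨
    (0 < w.1 ∧ width x w < 0 ∧ N * (-width x w) * w.1 ≤ 1 ∧ N * w.1 ^ 2 ≤ p.1 / width x p) := by
  have ha := hx.1.1
  have ha1 := hx.1.2
  have hu' : (1 : ℝ) ≤ u.1 := by exact_mod_cast hu
  have hw' : (0 : ℝ) ≤ w.1 := by exact_mod_cast hw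
  have hα' : (1 : ℝ) ≤ α := by exact_mod_cast hα
  have hN : (0 : ℝ) ≤ N := N.cast_nonneg
  have hβ : (0 : ℝ) ≤ β := β.cast_nonneg
  have hp1 : (p.1 : ℝ) = α * (u.1 + N * w.1) + β * w.1 := by
    rw [hp]; simp; ring
  have hpN : N * (w.1 : ℝ) ≤ p.1 := by
    rw [hp1]; nlinarith [mul_nonneg hN hw', mul_nonneg hβ hw']
  have hXp : width x p = α * (width x u + N * width x w) + β * width x w := by
    rw [hp, width_add, width_nsmul, width_nsmul, width_add, width_nsmul]
  have huw' := width_mul_sub x u w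
  rw [huw] at huw'
  push_cast at huw'
  rcases hw.eq_or_lt with hw0 | hw0
  · left
    have hw2' : (1 : ℝ) ≤ w.2 := by exact_mod_cast hw2
    have hu2' : (0 : ℝ) ≤ u.2 := by exact_mod_cast hu2
    have e1 : width x w = -(x.1 * w.2) := by simp [width, ← hw0]
    have h1 : u.1 = 1 := by
      have : u.1 * w.2 = 1 := by simpa [cross, ← hw0] using huw
      exact Int.eq_one_of_mul_eq_one_right hu.le this
    have e2 : width x u ≤ 1 := by
      simp only [width, h1]
      push_cast
      nlinarith [hx.2.1.2]
    have h3 : 0 < width x u + N * width x w := by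
      by_contra! hc
      rw [e1] at hc hXp
      have := mul_nonneg hβ (mul_nonneg ha.le (by linarith : (0 : ℝ) ≤ w.2))
      nlinarith
    rw [e1] at h3
    nlinarith [mul_nonneg ha.le hN]
  right
  have hw1 : (1 : ℝ) ≤ w.1 := by exact_mod_cast hw0
  have hp0 : (0 : ℝ) < p.1 := by
    rw [hp1]; nlinarith [mul_nonneg hN hw', mul_nonneg hβ hw']
  rcases lt_trichotomy (width x w) 0 with h | h | h
  · right; right
    -- As w has negative width, p can only have positive width if u + N w already does; then
    -- width(u) w.1 ≤ a ≤ 1 limits N.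
    have h3 : 0 < width x u + N * width x w := by
      by_contra! hc
      nlinarith
    have h4 : N * (-width x w) * w.1 ≤ 1 := by nlinarith
    refine ⟨hw0, h, h4, ?_⟩
    rw [le_div_iff₀ hX]
    have h5 := width_mul_sub x (u + N • w) p
    have hcr : cross (u + N • w) w = 1 := by
      have := cross_comb_left u w 1 N
      rwa [one_smul, Nat.cast_one, one_mul, huw] at this
    rw [show cross (u + N • w) p = β by rw [hp, cross_comb_right, hcr, mul_one], width_add,
      width_nsmul, Prod.fst_add, Prod.smul_fst, nsmul_eq_mul] at h5
    push_cast at h5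
    have h6 : width x u * w.1 ≤ 1 := by nlinarith
    have h7 : width x p * (N * w.1) ≤ width x u * p.1 := by
      have g1 : 0 ≤ N * (-width x w) * p.1 := by
        have : 0 ≤ - width x w := by linarith
        positivity
      have g2 : 0 ≤ width x p * u.1 := by positivity
      have g3 : 0 ≤ x.1 * β := by positivity
      nlinarith
    calc N * (w.1 : ℝ) ^ 2 * width x p = width x p * (N * w.1) * w.1 := by ring
      _ ≤ width x u * p.1 * w.1 := by gcongr
      _ = width x u * w.1 * p.1 := by ring
      _ ≤ 1 * p.1 := by gcongr
      _ = p.1 := one_mul _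
  · right; left
    exact ⟨hw0, h⟩
  · left
    have hXu : 0 < width x u := by
      have : 0 < width x u * w.1 := by nlinarith
      exact pos_of_mul_pos_left this hw'
    refine ⟨hw0, h, ?_, ?_⟩
    · have : 0 ≤ β * width x w := by positivity
      have : 0 ≤ N * width x w := by positivity
      nlinarith
    · refine hpN.trans ?_
      rw [le_div_iff₀ hX]
      nlinarith

/-- At a run the pair (u, w) has one vector repeatedly added to the other. The visited vectors at
the end have width in (0, 1], which forces the added vector to be a good approximation; the
Diophantine bounds then cap the run. The summand 1 / a covers a `false` run with w.1 = 0. -/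
theorem run_bound (hne : ∀ z : ℤ × ℤ, 0 < z.1 → width x z ≠ 0) {θ c : ℝ} (hθ : 0 < θ) (hθ1 : θ ≤ 1)
    (hc : 0 < c) (hodd : OddBound x θ c) (heven : EvenBound x θ c) (n : ℕ) (l : List Bool)
    (hl : act l stdBasis = (vec x (n + 1), vec x (n + 2)))
    (l₁ : List Bool) (N : ℕ) (y : Bool) (l₂ : List Bool)
    (hsplit : l = l₁ ++ List.replicate N y ++ l₂) :
    (N : ℝ) ≤ (2 / c + 1 / x.1) * slope x (n + 2) ^ θ := by
  have ha := hx.1.1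
  have ht1 := one_le_slope hx (n + 1)
  have htθ : 1 ≤ slope x (n + 2) ^ θ := Real.one_le_rpow ht1 hθ.le
  have ht0 : slope x (n + 1) ≤ slope x (n + 2) := slope_mono hx (Nat.le_succ _)
  have hnn := act_stdBasis_nonneg l₂
  have hcr := cross_act_stdBasis l₂
  obtain ⟨α, β, γ, δ, hdet, hcomb⟩ := act_eq_combination l₁
  have hαδ : α * δ ≠ 0 := by omega
  have hα : 1 ≤ α := Nat.one_le_iff_ne_zero.2 (left_ne_zero_of_mul hαδ)
  have hδ : 1 ≤ δ := Nat.one_le_iff_ne_zero.2 (right_ne_zero_of_mul hαδ)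
  rw [hsplit, act_append, act_append, hcomb] at hl
  generalize act l₂ stdBasis = z at *
  have hX1 := coord_pos hx (n + 1)
  have hX2 := coord_pos hx (n + 2)
  have hY1 := coord_le_one hx (n + 1)
  have hY2 := coord_le_one hx (n + 2)
  rw [slope] at ht0
  rw [coord_eq_width] at hX1 hX2 hY1 hY2 ht0
  suffices h : c * N ≤ 2 * slope x (n + 2) ^ θ ∨ x.1 * N ≤ 1 by
    have g1 : 0 ≤ 2 / c := by positivity
    have g2 : 0 ≤ 1 / x.1 := by positivity
    rcases h with h | h
    · have : N ≤ 2 * slope x (n + 2) ^ θ / c := by rw [le_div_iff₀ hc]; linarith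
      calc (N : ℝ) ≤ 2 * slope x (n + 2) ^ θ / c := this
        _ = 2 / c * slope x (n + 2) ^ θ := by ring
        _ ≤ _ := by gcongr; linarith
    · have : (N : ℝ) ≤ 1 / x.1 := by rw [le_div_iff₀ ha]; linarith
      nlinarith
  rcases Nat.eq_zero_or_pos N with rfl | hN
  · right; simp
  have hN' : (0 : ℝ) < N := by exact_mod_cast hN
  cases y
  · rw [act_replicate_false, Prod.ext_iff] at hl
    obtain h | ⟨hw, h1, h2, h3⟩ | ⟨hw, h⟩ | ⟨hw, h1, h2, h3⟩ := false_run_bound hx hcr (by omega)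
      hnn.2.2.1 (by omega) hα hl.1.symm hnn.2.1 hX1 hY1
    · exact Or.inr h
    · left
      have := mul_le_of_pos_width hθ.le hθ1 (by exact_mod_cast hw) h1
        (hodd _ (cross_isCoprime_right hcr) hw h1) hN' h2 (h3.trans ht0)
      linarith
    · exact absurd h (hne _ hw)
    · left
      have := mul_le_of_neg_width hθ.le hθ1 (by exact_mod_cast hw) (neg_pos.2 h1)
        (heven _ (cross_isCoprime_right hcr) hw h1) hN' h2 (h3.trans ht0)
      linarith
  · rw [act_replicate_true, Prod.ext_iff] at hl
    obtain ⟨h1, h2, h3⟩ := true_run_bound hx hcr (by omega) hnn.2.2.1 hδ hl.2.symm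
      (vec_fst_pos hx _) hX2 hY2
    left
    rw [← coord_eq_width] at h3
    exact mul_le_of_width_le hθ.le (by exact_mod_cast (show 0 < z.1.1 by omega)) h1
      (hodd _ (cross_isCoprime_left hcr) (by omega) h1) hN'.le h2 h3

theorem vec_snd_le (n : ℕ) : x.1 * (vec x n).2 ≤ (vec x n).1 := by
  have h := coord_pos hx n
  rw [coord_eq_width, width] at h
  have : (0 : ℝ) ≤ (vec x n).1 := by exact_mod_cast vec_fst_nonneg hx n
  nlinarith [hx.2.1.2]

/-- Diophantine lower bounds give the upper bound `O(n ^ θ log n)` for the partial sums. -/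
theorem exists_abs_partialSum_le (hne : ∀ z : ℤ × ℤ, 0 < z.1 → width x z ≠ 0) {θ c : ℝ}
    (hθ : 0 < θ) (hθ1 : θ ≤ 1)
    (hc : 0 < c) (hodd : OddBound x θ c) (heven : EvenBound x θ c) :
    ∃ C : ℝ, 0 < C ∧ ∀ n : ℕ, 1 ≤ n →
      |(partialSum x n : ℝ)| ≤ C * (n : ℝ) ^ θ * (1 + Real.log n) := by
  have ha := hx.1.1
  have hxx : x.1 ≠ x.2 := by
    have := hne (1, 1) one_pos
    simp only [width] at this
    intro h; rw [h] at this; simp at this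
  obtain ⟨D, hD, hslope⟩ := exists_slope_le hx hxx
  set B := 2 / c + 1 / x.1 with hB
  have hB0 : 0 < B := by positivity
  have hlog2 : 0 < Real.log 2 := Real.log_pos one_lt_two
  set K := 2 * (1 + 1 / x.1) * (3 * D) + 1 with hK
  have hK1 : 1 ≤ K := by
    have : 0 ≤ 2 * (1 + 1 / x.1) * (3 * D) := by positivity
    linarith
  have hlogK : 0 ≤ Real.log K := Real.log_nonneg hK1
  set M := (Real.log K + 1) / Real.log 2 + 1 with hM
  have hM0 : 0 < M := by positivity
  refine ⟨3 + 2 * (B * (3 * D) ^ θ) * M, by positivity, fun n hn => ?_⟩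
  obtain ⟨n, rfl⟩ := Nat.exists_eq_add_of_le' hn
  obtain ⟨l, hl, hb⟩ := exists_word hx n
  have hn1 : (1 : ℝ) ≤ (n + 1 : ℕ) := by exact_mod_cast hn
  have hlogn : 0 ≤ Real.log (n + 1 : ℕ) := Real.log_nonneg hn1
  have ht : slope x (n + 2) ≤ 3 * D * (n + 1 : ℕ) := by
    have := hslope (n + 2)
    push_cast at this ⊢
    nlinarith [n.cast_nonneg (α := ℝ)]
  have ht1 := one_le_slope hx (n + 1)
  have hrun : ∀ l₁ N y l₂, l = l₁ ++ List.replicate N y ++ l₂ →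
      (N : ℝ) ≤ B * ((3 * D) ^ θ * ((n + 1 : ℕ) : ℝ) ^ θ) := by
    intro l₁ N y l₂ h
    refine (run_bound hx hne hθ hθ1 hc hodd heven n l hl l₁ N y l₂ h).trans ?_
    rw [← Real.mul_rpow (by positivity) (by positivity)]
    gcongr
  -- K (n + 1) dominates the sum of the four entries of the pair, so its binary logarithm, rounded
  -- up, bounds the number of pairs of runs.
  obtain ⟨e, he1, he2⟩ : ∃ e : ℕ, K * (n + 1 : ℕ) ≤ 2 ^ e ∧ (e : ℝ) ≤ M * (1 + Real.log (n + 1 : ℕ)) := by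
    have hKn : 0 < K * (n + 1 : ℕ) := by positivity
    have hlKn : 0 ≤ Real.log (K * (n + 1 : ℕ)) := Real.log_nonneg (by nlinarith)
    refine ⟨⌈Real.log (K * (n + 1 : ℕ)) / Real.log 2⌉₊, ?_, ?_⟩
    · rw [← Real.log_le_log_iff hKn (by positivity), Real.log_pow, ← div_le_iff₀ hlog2]
      exact Nat.le_ceil _
    · refine (Nat.ceil_lt_add_one (by positivity)).le.trans ?_
      rw [Real.log_mul (by positivity) (by positivity), hM, add_mul, one_mul]
      refine add_le_add ?_ (by linarith)
      rw [div_mul_eq_mul_div]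
      gcongr
      nlinarith
  have hsize : (act l stdBasis).1.1 + (act l stdBasis).1.2 + (act l stdBasis).2.1
      + (act l stdBasis).2.2 ≤ 2 ^ e := by
    rw [hl]
    have g : ∀ m ≤ n + 2, ((vec x m).1 + (vec x m).2 : ℝ) ≤ (1 + 1 / x.1) * (3 * D * (n + 1 : ℕ)) := by
      intro m hm
      have g1 := (vec_fst_le_slope hx m).trans ((slope_mono hx hm).trans ht)
      have g2 : ((vec x m).2 : ℝ) ≤ 1 / x.1 * (vec x m).1 := by
        rw [div_mul_eq_mul_div, le_div_iff₀ ha]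
        linarith [vec_snd_le hx m]
      have g3 : 0 ≤ 1 / x.1 := by positivity
      nlinarith
    have g1 := g (n + 1) (by omega)
    have g2 := g (n + 2) le_rfl
    have : ((vec x (n + 1)).1 + (vec x (n + 1)).2 + (vec x (n + 2)).1 + (vec x (n + 2)).2 : ℝ)
        ≤ 2 ^ e := by
      refine le_trans ?_ he1
      rw [hK]
      nlinarith
    exact_mod_cast this
  have h := abs_balance_le _ e l hrun hsize
  have hp : (partialSum x (n + 1) : ℝ) = balance l - 3 := by rw [hb]; push_cast; ring
  have hnθ : 1 ≤ ((n + 1 : ℕ) : ℝ) ^ θ := Real.one_le_rpow hn1 hθ.le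
  have h3 : (3 : ℝ) ≤ 3 * ((n + 1 : ℕ) : ℝ) ^ θ * (1 + Real.log (n + 1 : ℕ)) := by nlinarith
  have h4 : 2 * (B * ((3 * D) ^ θ * ((n + 1 : ℕ) : ℝ) ^ θ)) * e
      ≤ 2 * (B * ((3 * D) ^ θ * ((n + 1 : ℕ) : ℝ) ^ θ)) * (M * (1 + Real.log (n + 1 : ℕ))) := by
    gcongr
  calc |(partialSum x (n + 1) : ℝ)| ≤ |(balance l : ℝ)| + |(3 : ℝ)| := by
        rw [hp]; exact abs_sub _ _
    _ = |(balance l : ℝ)| + 3 := by norm_num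
    _ ≤ _ := by linarith

end Run

/-! ### Good approximations force large partial sums -/

/-- A lower Farey neighbour. -/
theorem exists_lower_neighbour {w : ℤ × ℤ} (hw : IsCoprime w.1 w.2) (hw1 : 0 < w.1) :
    ∃ u : ℤ × ℤ, 0 < u.1 ∧ u.1 ≤ w.1 ∧ cross u w = 1 := by
  obtain ⟨c, d, hcd⟩ := hw
  -- The Bézout solution (d, -c) is shifted by a multiple of w; the shift of d by one puts the
  -- residue in 1, ..., w.1 instead of 0, ..., w.1 - 1.
  refine ⟨((d - 1) % w.1 + 1, -c - w.2 * ((d - 1) / w.1)), ?_, ?_, ?_⟩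
  · have := Int.emod_nonneg (d - 1) hw1.ne'
    simp only; omega
  · have := Int.emod_lt_of_pos (d - 1) hw1
    simp only; omega
  · have := Int.emod_add_mul_ediv (d - 1) w.1
    simp only [cross]
    linear_combination hcd + w.2 * this

section Large

variable {x : ℝ × ℝ} (hx : x ∈ fareyTriangle)
include hx

/-- A primitive vector of small positive width forces a large partial sum. -/
theorem exists_partialSum_large_of_pos_width {z : ℤ × ℤ} (hz : IsCoprime z.1 z.2) (hz1 : 0 < z.1)
    (hX : 0 < width x z) (hX1 : width x z ≤ 1) :
    ∃ n : ℕ, (n : ℝ) ≤ z.1 / (x.1 * width x z) ∧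
      1 / width x z - 4 ≤ 2 * |(partialSum x n : ℝ)| := by
  obtain ⟨n, rfl⟩ := exists_vec_eq hx hz hz1 hX hX1
  have ha := hx.1.1
  have hn := mul_le_slope hx (n + 1)
  have hi := lt_ind_add_one_mul hx n
  have h0 := coord_pos hx n
  have h1 := coord_pos hx (n + 1)
  rw [← coord_eq_width]
  have hle : ((n + 1 : ℕ) : ℝ) ≤ (vec x (n + 1)).1 / (x.1 * coord x (n + 1)) := by
    rw [slope, le_div_iff₀ h1] at hn
    rw [le_div_iff₀ (by positivity)]
    linarith
  have hk : 1 / coord x (n + 1) - 1 ≤ ind x n := by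
    rw [sub_le_iff_le_add, div_le_iff₀ h1]
    linarith
  -- A large index is a jump of the sum, so one of the two sums beside it has at least half its
  -- size.
  have hs : (ind x n : ℝ) = partialSum x (n + 1) - partialSum x n + 3 := by
    rw [partialSum_succ]; push_cast; ring
  by_contra! hc
  have c1 := hc (n + 1) hle
  have c2 := hc n (le_trans (by push_cast; linarith) hle)
  have a1 := le_abs_self (partialSum x (n + 1) : ℝ)
  have a2 := neg_abs_le (partialSum x n : ℝ)
  linarith

/-- The normalised form of the negative case: u = (1, 0), w = (g, 1), and u + m w is visited.
Uniqueness of words gives `true`^h `false`^m `true`^g, of balance g + h - m. The runs of `true` at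
both ends are cancelled by the indices at the two visits, which exceed g and h. -/
theorem partialSum_sub_le_of_vec_eq {g m : ℕ} {k : ℕ} (hw : width x (g, 1) < 0) (hm : 0 < m)
    (hv : vec x (k + 2) = ((1 + m * g : ℤ), (m : ℤ))) :
    partialSum x (k + 1) - partialSum x 1 ≤ 1 - m := by
  obtain ⟨l, hl, hb⟩ := exists_word hx (k + 1)
  simp only [Nat.add_assoc, Nat.reduceAdd] at hl hb
  have hcr := cross_vec_succ x (k + 2)
  have hr := vec_snd_pos hx (k + 1)
  rw [show k + 1 + 2 = k + 2 + 1 by ring] at hr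
  simp only [cross, hv] at hcr
  have hm' : (0 : ℤ) < m := by exact_mod_cast hm
  obtain ⟨h, hh⟩ : ∃ h : ℕ, (vec x (k + 3)).1 - g * (vec x (k + 3)).2 = h := by
    apply Int.eq_ofNat_of_zero_le
    by_contra! hneg
    have : (vec x (k + 2 + 1)).2
        = 1 + m * ((vec x (k + 2 + 1)).1 - g * (vec x (k + 2 + 1)).2) := by linarith
    nlinarith
  have h2 : (vec x (k + 3)).2 = 1 + m * h := by rw [← hh]; linarith
  have h1 : (vec x (k + 3)).1 = h + g * (1 + m * h) := by rw [← h2, ← hh]; ring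
  have hword : l = List.replicate h true ++ (List.replicate m false ++ List.replicate g true) := by
    apply act_stdBasis_injective
    simp only
    rw [hl, act_append, act_append, act_replicate_true, act_replicate_false, act_replicate_true, hv]
    simp only [Prod.ext_iff, stdBasis, Prod.fst_add, Prod.snd_add, Prod.smul_fst, Prod.smul_snd]
    simp only [nsmul_eq_mul]
    rw [h1, h2]
    refine ⟨⟨?_, ?_⟩, ?_, ?_⟩ <;> ring
  rw [hword, balance_append, balance_append, balance_replicate_true, balance_replicate_true,
    balance_replicate_false] at hb
  have hg : (g : ℤ) < ind x 0 := by
    have hX := coord_pos hx 2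
    rw [coord_eq_width, vec_rec, vec_one, vec_zero] at hX
    simp [width] at hX hw
    have hbpos := hx.2.1.1
    have : (g : ℝ) < ind x 0 := by
      by_contra! hc
      nlinarith
    exact_mod_cast this
  have hi : (h : ℤ) < ind x (k + 1) := by
    have hrec := vec_rec_snd x (k + 1)
    rw [show k + 1 + 2 = k + 3 by ring, show k + 1 + 1 = k + 2 by ring, h2, hv] at hrec
    have hnn := vec_snd_nonneg hx k
    by_contra! hc
    nlinarith
  have e1 : partialSum x (k + 2) = partialSum x (k + 1) + (ind x (k + 1) - 3) :=
    partialSum_succ x (k + 1)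
  have e2 : partialSum x 1 = ind x 0 - 3 := by simp [partialSum_eq]
  linarith

/-- A primitive vector of small negative width forces a large partial sum. -/
theorem exists_partialSum_large_of_neg_width {w : ℤ × ℤ} (hw : IsCoprime w.1 w.2) (hw1 : 0 < w.1)
    (hX : width x w < 0) (hX1 : 2 * (-width x w) * w.1 ≤ x.1) {m : ℕ} (hm : 0 < m)
    (hmX : 4 * m * (-width x w) * w.1 ≤ x.1) :
    ∃ n : ℕ, (n : ℝ) ≤ 4 / x.1 ^ 2 * w.1 ^ 2 * (m + 1) ∧
      (m : ℝ) - 1 ≤ 2 * |(partialSum x n : ℝ)| := by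
  have ha := hx.1.1
  have ha1 := hx.1.2
  have hq : (1 : ℝ) ≤ w.1 := by exact_mod_cast hw1
  obtain ⟨u, hu1, hu2, huw⟩ := exists_lower_neighbour hw hw1
  have hu1' : (1 : ℝ) ≤ u.1 := by exact_mod_cast hu1
  have hu2' : (u.1 : ℝ) ≤ w.1 := by exact_mod_cast hu2
  have hm' : (1 : ℝ) ≤ m := by exact_mod_cast hm
  have hwid := width_mul_sub x u w
  rw [huw] at hwid
  push_cast at hwid
  have hε : 0 < -width x w := by linarith
  set z : ℤ × ℤ := u + m • w with hz
  have hzw : width x z = width x u - m * (-width x w) := by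
    rw [hz, width_add, width_nsmul]; ring
  have hXu1 : width x u ≤ 1 := by nlinarith
  -- The lower neighbour has width at least a / (2q), and the bound on m spends at most half of
  -- that.
  have hzX : x.1 ≤ 4 * w.1 * width x z := by
    rw [hzw]; nlinarith
  have hzpos : 0 < width x z := by
    by_contra! hc
    nlinarith
  have hmε : 0 < m * (-width x w) := by positivity
  have hXu : 0 < width x u := by linarith
  have hczw : cross z w = 1 := by
    have := cross_comb_left u w 1 m
    rwa [one_smul, Nat.cast_one, one_mul, huw] at this
  have hcuz : cross u z = m := by
    have := cross_comb_right u w 1 m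
    rwa [one_smul, huw, mul_one] at this
  have hz1 : z.1 = u.1 + m * w.1 := by simp [hz]
  have hz1' : (z.1 : ℝ) = u.1 + m * w.1 := by rw [hz1]; push_cast; ring
  have hzp : 0 < z.1 := by rw [hz1]; positivity
  obtain ⟨i, hi⟩ := exists_vec_eq hx (cross_isCoprime_left huw) hu1 hXu hXu1
  obtain ⟨j, hj⟩ := exists_vec_eq hx (cross_isCoprime_left hczw) hzp hzpos (by linarith)
  have hij : i < j := by
    by_contra! hc
    have hmono := slope_mono hx (Nat.succ_le_succ hc)
    rw [slope, slope, coord_eq_width, coord_eq_width, hi, hj, div_le_div_iff₀ hzpos hXu] at hmono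
    have := width_mul_sub x u z
    rw [hcuz] at this
    push_cast at this
    have : 0 < x.1 * m := by positivity
    linarith
  obtain ⟨k, rfl⟩ := Nat.exists_eq_add_of_lt hij
  have hvi : cross (vec x i) u = 1 := by rw [← hi]; exact cross_vec_succ x i
  have hgnn : 0 ≤ cross (vec x i) w := by
    have h := width_mul_sub x (vec x i) w
    rw [← coord_eq_width] at h
    have h1 := coord_pos hx i
    have h2 : (0 : ℝ) ≤ (vec x i).1 := by exact_mod_cast vec_fst_nonneg hx i
    have h3 : 0 ≤ x.1 * (cross (vec x i) w : ℤ) := by nlinarith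
    have h4 : (0 : ℝ) ≤ (cross (vec x i) w : ℤ) := nonneg_of_mul_nonneg_right h3 ha
    exact_mod_cast h4
  obtain ⟨g, hg⟩ := Int.eq_ofNat_of_zero_le hgnn
  -- Restarting at time i, where v_{i+1} = u, turns u into (1, 0), w into (g, 1) and z into (1 + m
  -- g, m).
  have hwid' : width (bczMap^[i] x) (g, 1) < 0 := by
    have h := width_iterate x i w
    rw [hi, huw, hg] at h
    rw [h]; exact hX
  have hvec : vec (bczMap^[i] x) (k + 2) = ((1 + m * g : ℤ), (m : ℤ)) := by
    have hz' : vec x (k + 2 + i) = z := by rw [← hj]; congr 1; ring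
    refine Prod.ext ?_ ?_
    · rw [vec_iterate_fst, hz', ← hg]
      have : cross (vec x i) z = cross (vec x i) u + m * cross (vec x i) w := by
        simp only [hz, cross, Prod.fst_add, Prod.snd_add, Prod.smul_fst, Prod.smul_snd]
        simp only [nsmul_eq_mul]; ring
      rw [this, hvi]
    · rw [vec_iterate_snd, hz', hi, hcuz]
  have hmain := partialSum_sub_le_of_vec_eq (iterate_mem hx i) hwid' hm hvec
  rw [partialSum_iterate, partialSum_iterate] at hmain
  have hmain' : (partialSum x (k + 1 + i) : ℝ) - partialSum x (1 + i) ≤ 1 - m := by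
    exact_mod_cast (by linarith : partialSum x (k + 1 + i) - partialSum x (1 + i) ≤ 1 - (m : ℤ))
  have hle : ((i + k + 1 + 1 : ℕ) : ℝ) ≤ 4 / x.1 ^ 2 * w.1 ^ 2 * (m + 1) := by
    have h := mul_le_slope hx (i + k + 1 + 1)
    rw [slope, coord_eq_width, hj, le_div_iff₀ hzpos] at h
    rw [div_mul_eq_mul_div, div_mul_eq_mul_div, le_div_iff₀ (by positivity)]
    have h5 : (0 : ℝ) ≤ (i + k + 1 + 1 : ℕ) := by positivity
    calc ((i + k + 1 + 1 : ℕ) : ℝ) * x.1 ^ 2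
        = x.1 * (i + k + 1 + 1 : ℕ) * x.1 := by ring
      _ ≤ x.1 * (i + k + 1 + 1 : ℕ) * (4 * w.1 * width x z) := by gcongr
      _ = x.1 * (i + k + 1 + 1 : ℕ) * width x z * (4 * w.1) := by ring
      _ ≤ z.1 * (4 * w.1) := by gcongr
      _ ≤ (w.1 + m * w.1) * (4 * w.1) := by rw [hz1']; gcongr
      _ = 4 * (w.1 : ℝ) ^ 2 * (m + 1) := by ring
  by_contra! hc
  have c1 := hc (k + 1 + i) (le_trans (by push_cast; linarith) hle)
  have c2 := hc (1 + i) (le_trans (by push_cast; linarith [k.cast_nonneg (α := ℝ)]) hle)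
  have a1 := neg_abs_le (partialSum x (k + 1 + i) : ℝ)
  have a2 := le_abs_self (partialSum x (1 + i) : ℝ)
  linarith

end Large

/-! ### One-sided rational approximation and the exponents -/

theorem finite_rat_den_le (s : ℝ) (D : ℕ) : {r : ℚ | |s - r| ≤ 1 ∧ r.den ≤ D}.Finite := by
  obtain ⟨M, hM⟩ := exists_nat_ge ((|s| + 1) * D)
  refine (((Set.finite_Icc (-(M : ℤ)) M).prod (Set.finite_Iic D)).image
    fun p : ℤ × ℕ => (p.1 / p.2 : ℚ)).subset ?_
  rintro r ⟨hr, hD⟩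
  refine ⟨(r.num, r.den), ⟨?_, hD⟩, Rat.num_div_den r⟩
  have hd : (0 : ℝ) < r.den := by exact_mod_cast r.den_pos
  have hnum : (r.num : ℝ) = r * r.den := by
    rw [Rat.cast_def, div_mul_cancel₀ _ hd.ne']
  have h1 : |(r : ℝ)| ≤ |s| + 1 := by
    have : (r : ℝ) = s - (s - r) := by ring
    rw [this]; exact (abs_sub _ _).trans (by linarith)
  have h2 : |(r.num : ℝ)| ≤ M := by
    rw [hnum, abs_mul, abs_of_pos hd]
    refine le_trans ?_ hM
    have : (r.den : ℝ) ≤ D := by exact_mod_cast hD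
    gcongr
  have h3 : |r.num| ≤ (M : ℤ) := by exact_mod_cast h2
  exact Set.mem_Icc.2 (abs_le.1 h3)

theorem exists_den_gt {s : ℝ} {S : Set ℚ} (hS : S.Infinite) (hs : ∀ r ∈ S, |s - r| ≤ 1) (D : ℕ) :
    ∃ r ∈ S, D < r.den := by
  by_contra! hc
  exact hS ((finite_rat_den_le s D).subset fun r hr => ⟨hs r hr, hc r hr⟩)

theorem exists_pos_le_of_finite {S : Set ℚ} (hS : S.Finite) {f : ℚ → ℝ} (hf : ∀ r ∈ S, 0 < f r) :
    ∃ η, 0 < η ∧ η ≤ 1 ∧ ∀ r ∈ S, η ≤ f r := by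
  rcases S.eq_empty_or_nonempty with rfl | hne
  · exact ⟨1, one_pos, le_rfl, by simp⟩
  obtain ⟨r, hr, hmin⟩ := Set.exists_min_image S f hS hne
  exact ⟨min 1 (f r), lt_min one_pos (hf r hr), min_le_left _ _, fun y hy =>
    (min_le_right _ _).trans (hmin y hy)⟩

theorem exists_rat_of_isCoprime {z : ℤ × ℤ} (hz : IsCoprime z.1 z.2) (h1 : 0 < z.1) :
    ∃ r : ℚ, (r.den : ℤ) = z.1 ∧ r.num = z.2 := by
  refine ⟨⟨z.2, z.1.natAbs, by omega, ?_⟩, by simp [h1.le], rfl⟩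
  exact (Int.isCoprime_iff_gcd_eq_one.1 hz.symm)

theorem isCoprime_den_num (r : ℚ) : IsCoprime (r.den : ℤ) r.num :=
  (Rat.isCoprime_num_den r).symm

/-- Every irrational has infinitely many rational approximations of order two from below. -/
theorem infinite_lower_approx {s : ℝ} (hs : Irrational s) :
    {r : ℚ | 0 < s - r ∧ s - r < 1 / (r.den : ℝ) ^ (2 : ℝ)}.Infinite := by
  intro hfin
  obtain ⟨η, hη, -, hmin⟩ := exists_pos_le_of_finite hfin (f := fun r => s - r) fun r hr => hr.1
  have hinf := (Real.infinite_rat_abs_sub_lt_one_div_den_sq_of_irrational hs).sdiff hfin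
  obtain ⟨D, hD⟩ := exists_nat_gt (1 / η)
  obtain ⟨r, ⟨hr, hr'⟩, hrD⟩ := exists_den_gt (s := s) hinf (fun r hr => by
    refine (le_of_lt hr.1).trans ?_
    have : (1 : ℝ) ≤ r.den := by exact_mod_cast r.den_pos
    rw [div_le_one (by positivity)]
    exact one_le_pow₀ this) D
  have hq : (1 : ℝ) ≤ r.den := by exact_mod_cast r.den_pos
  have hneg : s - r < 0 := by
    by_contra! hc
    rcases hc.eq_or_lt with h | h
    · exact hs ⟨r, by linarith⟩
    · refine hr' ⟨h, ?_⟩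
      rw [Real.rpow_two]
      exact (le_abs_self _).trans_lt hr
  rw [Set.mem_ofPred_eq, abs_of_neg hneg, lt_div_iff₀ (by positivity)] at hr
  -- If only finitely many lower approximations existed, Dirichlet would give an upper one r of
  -- large denominator. Its lower neighbour t lies below s with s - t < 1 / (t.den * r.den), hence
  -- is itself a lower approximation of order two, yet closer to s than η.
  obtain ⟨u, hu, hur, hc⟩ := exists_lower_neighbour (w := (r.den, r.num)) (isCoprime_den_num r)
    (by simpa using r.den_pos)
  obtain ⟨t, ht1, ht2⟩ := exists_rat_of_isCoprime (cross_isCoprime_left hc) hu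
  simp only [cross, ← ht1, ← ht2] at hc hur
  have hp : (1 : ℝ) ≤ t.den := by exact_mod_cast t.den_pos
  have hpr : (t.den : ℝ) ≤ r.den := by exact_mod_cast hur
  have hc' : (t.den * r.num - t.num * r.den : ℝ) = 1 := by exact_mod_cast hc
  have er : (r.num : ℝ) = r * r.den := by
    rw [Rat.cast_def, div_mul_cancel₀ _ (by positivity)]
  have et : (t.num : ℝ) = t * t.den := by
    rw [Rat.cast_def, div_mul_cancel₀ _ (by positivity)]
  rw [er, et] at hc'
  have key : (s - t) * (t.den * r.den) = 1 + (s - r) * (t.den * r.den) := by linarith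
  have h1 : -(s - r) * (t.den * r.den) < 1 := by
    refine lt_of_le_of_lt ?_ hr
    rw [sq]
    have : 0 ≤ -(s - r) := by linarith
    gcongr
  have h0 : 0 < (t.den * r.den : ℝ) := by positivity
  have hpos : 0 < s - t := by
    by_contra! hc
    nlinarith
  have hlt : (s - t) * (t.den * r.den) < 1 := by nlinarith
  have hmem := hmin t ⟨hpos, by
    rw [lt_div_iff₀ (by positivity), Real.rpow_two, sq]
    refine lt_of_le_of_lt ?_ hlt
    gcongr⟩
  have hrD' : (D : ℝ) < r.den := by exact_mod_cast hrD
  rw [div_lt_iff₀ hη] at hD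
  have : η * r.den ≤ (s - t) * (t.den * r.den) := by
    gcongr
    nlinarith
  nlinarith

theorem infinite_upper_approx {s : ℝ} (hs : Irrational s) :
    {r : ℚ | 0 < r - s ∧ r - s < 1 / (r.den : ℝ) ^ (2 : ℝ)}.Infinite := by
  refine ((infinite_lower_approx hs.neg).image (f := fun r => -r) neg_injective.injOn).mono ?_
  rintro _ ⟨r, ⟨h1, h2⟩, rfl⟩
  refine ⟨?_, ?_⟩
  · push_cast; linarith
  · simp only [Rat.neg_den]
    push_cast; linarith

/-- The Diophantine exponent attached to a signed distance `δ`. -/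
noncomputable def approxExponent (δ : ℚ → ℝ) : EReal :=
  ⨆ v ∈ {v : ℝ | {r : ℚ | 0 < δ r ∧ δ r < 1 / (r.den : ℝ) ^ v}.Infinite}, (v : EReal)

theorem oddExponent_eq (s : ℝ) : oddExponent s = approxExponent fun r => s - r := rfl

theorem evenExponent_eq (s : ℝ) : evenExponent s = approxExponent fun r => r - s := rfl

theorem le_approxExponent {δ : ℚ → ℝ} {v : ℝ}
    (h : {r : ℚ | 0 < δ r ∧ δ r < 1 / (r.den : ℝ) ^ v}.Infinite) : (v : EReal) ≤ approxExponent δ :=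
  le_iSup₂ (f := fun (v : ℝ)
    (_ : v ∈ {v : ℝ | {r : ℚ | 0 < δ r ∧ δ r < 1 / (r.den : ℝ) ^ v}.Infinite}) => (v : EReal)) v h

theorem infinite_of_lt_approxExponent {δ : ℚ → ℝ} {v : ℝ} (h : (v : EReal) < approxExponent δ) :
    {r : ℚ | 0 < δ r ∧ δ r < 1 / (r.den : ℝ) ^ v}.Infinite := by
  rw [approxExponent, lt_iSup_iff] at h
  obtain ⟨v', h⟩ := h
  rw [lt_iSup_iff] at h
  obtain ⟨hinf, hlt⟩ := h
  refine Set.Infinite.mono ?_ hinf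
  rintro r ⟨h1, h2⟩
  refine ⟨h1, h2.trans_le ?_⟩
  have hq : (1 : ℝ) ≤ r.den := by exact_mod_cast r.den_pos
  have : v ≤ v' := (EReal.coe_lt_coe_iff.1 hlt).le
  gcongr

/-- Beyond the exponent only finitely many fractions violate the bound with constant 1, and a
smaller constant η absorbs them. -/
theorem exists_le_mul_rpow_of_approxExponent_lt {δ : ℚ → ℝ} {v : ℝ} (h : approxExponent δ < v) :
    ∃ η, 0 < η ∧ η ≤ 1 ∧ ∀ r, 0 < δ r → η ≤ (r.den : ℝ) ^ v * δ r := by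
  have hfin : {r : ℚ | 0 < δ r ∧ δ r < 1 / (r.den : ℝ) ^ v}.Finite := by
    by_contra hinf
    exact (le_approxExponent hinf).not_gt h
  have hpos : ∀ r : ℚ, 0 < (r.den : ℝ) ^ v := fun r =>
    Real.rpow_pos_of_pos (by exact_mod_cast r.den_pos) v
  obtain ⟨η, h0, h1, hη⟩ := exists_pos_le_of_finite hfin (f := fun r => (r.den : ℝ) ^ v * δ r)
    fun r hr => mul_pos (hpos r) hr.1
  refine ⟨η, h0, h1, fun r hr => ?_⟩
  by_cases hlt : δ r < 1 / (r.den : ℝ) ^ v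
  · exact hη r ⟨hr, hlt⟩
  · refine h1.trans ?_
    rw [not_lt, div_le_iff₀ (hpos r)] at hlt
    linarith

theorem width_den_num {x : ℝ × ℝ} (ha : 0 < x.1) (r : ℚ) :
    width x (r.den, r.num) = x.1 * r.den * (x.2 / x.1 - r) := by
  have hd : (0 : ℝ) < r.den := by exact_mod_cast r.den_pos
  rw [width, Rat.cast_def]
  push_cast
  field_simp

theorem oddBound_of_exponent_lt {x : ℝ × ℝ} (ha : 0 < x.1) {θ : ℝ} (hθ1 : θ < 1)
    (h : oddExponent (x.2 / x.1) < (1 / (1 - θ) : ℝ)) : ∃ c, 0 < c ∧ OddBound x θ c := by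
  obtain ⟨η, h0, -, hη⟩ := exists_le_mul_rpow_of_approxExponent_lt (oddExponent_eq _ ▸ h)
  have hθ' : 0 < 1 - θ := by linarith
  refine ⟨x.1 ^ (1 - θ) * η ^ (1 - θ), by positivity, fun z hz hz1 hX => ?_⟩
  obtain ⟨r, h1, h2⟩ := exists_rat_of_isCoprime hz hz1
  have hd : (0 : ℝ) < r.den := by exact_mod_cast r.den_pos
  have hzr : z = ((r.den : ℤ), r.num) := Prod.ext h1.symm h2.symm
  rw [hzr, width_den_num ha] at hX ⊢
  have hδ : 0 < x.2 / x.1 - r := by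
    rw [mul_pos_iff_of_pos_left (by positivity)] at hX
    exact hX
  have h3 := hη r hδ
  simp only [Int.cast_natCast]
  calc x.1 ^ (1 - θ) * η ^ (1 - θ)
      ≤ x.1 ^ (1 - θ) * ((r.den : ℝ) ^ (1 / (1 - θ)) * (x.2 / x.1 - r)) ^ (1 - θ) := by gcongr
    _ = (r.den : ℝ) ^ θ * (x.1 * r.den * (x.2 / x.1 - r)) ^ (1 - θ) := by
      rw [Real.mul_rpow (by positivity) hδ.le, Real.mul_rpow (by positivity) hδ.le,
        Real.mul_rpow ha.le hd.le, ← Real.rpow_mul hd.le, one_div_mul_cancel hθ'.ne', Real.rpow_one]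
      nth_rewrite 1 [← rpow_mul_rpow_one_sub hd θ]
      ring

theorem evenBound_of_exponent_lt {x : ℝ × ℝ} (ha : 0 < x.1) {θ : ℝ} (hθ1 : θ < 1)
    (h : evenExponent (x.2 / x.1) < (2 / (1 - θ) : ℝ)) : ∃ c, 0 < c ∧ EvenBound x θ c := by
  obtain ⟨η, h0, -, hη⟩ := exists_le_mul_rpow_of_approxExponent_lt (evenExponent_eq _ ▸ h)
  have hθ' : 0 < 1 - θ := by linarith
  refine ⟨x.1 ^ (1 - θ) * η ^ (1 - θ), by positivity, fun z hz hz1 hX => ?_⟩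
  obtain ⟨r, h1, h2⟩ := exists_rat_of_isCoprime hz hz1
  have hd : (0 : ℝ) < r.den := by exact_mod_cast r.den_pos
  have hzr : z = ((r.den : ℤ), r.num) := Prod.ext h1.symm h2.symm
  rw [hzr, width_den_num ha] at hX ⊢
  have hδ : 0 < r - x.2 / x.1 := by
    by_contra! hc
    have : 0 ≤ x.1 * r.den * (x.2 / x.1 - r) := mul_nonneg (by positivity) (by linarith)
    linarith
  have h3 := hη r hδ
  simp only [Int.cast_natCast]
  rw [← mul_neg, neg_sub]
  have h4 : (r.den : ℝ) ^ (1 + θ) * (r.den : ℝ) ^ (1 - θ) = (r.den : ℝ) ^ (2 : ℝ) := by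
    rw [← Real.rpow_add hd]; congr 1; ring
  calc x.1 ^ (1 - θ) * η ^ (1 - θ)
      ≤ x.1 ^ (1 - θ) * ((r.den : ℝ) ^ (2 / (1 - θ)) * (r - x.2 / x.1)) ^ (1 - θ) := by gcongr
    _ = (r.den : ℝ) ^ (1 + θ) * (x.1 * r.den * (r - x.2 / x.1)) ^ (1 - θ) := by
      rw [Real.mul_rpow (by positivity) hδ.le, Real.mul_rpow (by positivity) hδ.le,
        Real.mul_rpow ha.le hd.le, ← Real.rpow_mul hd.le, div_mul_cancel₀ _ hθ'.ne', ← h4]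
      ring

theorem oddBound_one (x : ℝ × ℝ) : OddBound x 1 1 := by
  intro z _ hz _
  simpa using (by exact_mod_cast hz : (1 : ℝ) ≤ z.1)

theorem evenBound_one (x : ℝ × ℝ) : EvenBound x 1 1 := by
  intro z _ hz _
  have : (1 : ℝ) ≤ z.1 := by exact_mod_cast hz
  simpa using Real.one_le_rpow this (by norm_num : (0 : ℝ) ≤ 1 + 1)

theorem OddBound.mono {x : ℝ × ℝ} {θ c c' : ℝ} (h : OddBound x θ c) (hc : c' ≤ c) :
    OddBound x θ c' := fun z h1 h2 h3 => hc.trans (h z h1 h2 h3)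

theorem EvenBound.mono {x : ℝ × ℝ} {θ c c' : ℝ} (h : EvenBound x θ c) (hc : c' ≤ c) :
    EvenBound x θ c' := fun z h1 h2 h3 => hc.trans (h z h1 h2 h3)

theorem exists_natCast_rpow_ge {p : ℝ} (hp : 0 < p) (H : ℝ) :
    ∃ D : ℕ, ∀ n : ℕ, D ≤ n → H ≤ (n : ℝ) ^ p := by
  have := ((tendsto_rpow_atTop hp).comp tendsto_natCast_atTop_atTop).eventually_ge_atTop H
  exact eventually_atTop.1 this

/-! ### From exponents to frequently large partial sums -/

section Frequent

variable {x : ℝ × ℝ} (hx : x ∈ fareyTriangle)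
include hx

theorem partialSum_large_of_odd {θ : ℝ} (hθ : 0 < θ) (hθ1 : θ < 1)
    (hinf : {r : ℚ | 0 < x.2 / x.1 - r ∧
      x.2 / x.1 - r < 1 / (r.den : ℝ) ^ (1 / (1 - θ))}.Infinite) :
    ∃ c : ℝ, 0 < c ∧ ∀ H : ℝ, ∃ n : ℕ, H ≤ |(partialSum x n : ℝ)| ∧
      c * (n : ℝ) ^ θ ≤ |(partialSum x n : ℝ)| := by
  have ha := hx.1.1
  have ha1 := hx.1.2
  have hθ' : 0 < 1 - θ := by linarith
  refine ⟨x.1 ^ θ / 4, by positivity, fun H => ?_⟩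
  -- The 8 makes 1 / X ≥ 8, so that (1 / X - 4) / 2 ≥ 1 / (4X); the 4H then makes the sum exceed H.
  obtain ⟨D, hD⟩ := exists_natCast_rpow_ge (div_pos hθ hθ') (max 8 (4 * H))
  obtain ⟨r, ⟨h1, h2⟩, hr⟩ := exists_den_gt (s := x.2 / x.1) hinf (fun r hr => by
    rw [abs_of_pos hr.1]
    refine hr.2.le.trans ?_
    have : (1 : ℝ) ≤ r.den := by exact_mod_cast r.den_pos
    rw [div_le_one (by positivity)]
    exact Real.one_le_rpow this (by positivity)) D
  have hq : (0 : ℝ) < r.den := by exact_mod_cast r.den_pos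
  have hX : 0 < width x (r.den, r.num) := by
    rw [width_den_num ha]; positivity
  have hXlt : width x (r.den, r.num) * (r.den : ℝ) ^ (θ / (1 - θ)) ≤ 1 := by
    rw [width_den_num ha]
    rw [lt_div_iff₀ (by positivity)] at h2
    have e : (r.den : ℝ) ^ (1 / (1 - θ)) = r.den * (r.den : ℝ) ^ (θ / (1 - θ)) := by
      rw [show 1 / (1 - θ) = 1 + θ / (1 - θ) by field_simp; ring, Real.rpow_add hq, Real.rpow_one]
    rw [e] at h2
    nlinarith
  have hbig := hD r.den hr.le
  have hY : (r.den : ℝ) ^ (θ / (1 - θ)) ≤ 1 / width x (r.den, r.num) := by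
    rw [le_div_iff₀ hX]; linarith
  have hX1 : width x (r.den, r.num) ≤ 1 := by
    have : 1 ≤ (r.den : ℝ) ^ (θ / (1 - θ)) := le_trans (by norm_num) ((le_max_left _ _).trans hbig)
    nlinarith
  obtain ⟨n, hn, hf⟩ := exists_partialSum_large_of_pos_width hx (z := (r.den, r.num))
    (isCoprime_den_num r) (by simpa using r.den_pos) hX hX1
  generalize width x (r.den, r.num) = X at *
  set Y := 1 / X with hYdef
  have hY0 : 0 < Y := by positivity
  have hY8 : max 8 (4 * H) ≤ Y := hbig.trans hY
  have h8 := (le_max_left _ _).trans hY8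
  have h4 := (le_max_right _ _).trans hY8
  have hfY : Y / 4 ≤ |(partialSum x n : ℝ)| := by linarith
  refine ⟨n, by linarith, le_trans ?_ hfY⟩
  have hqY : (r.den : ℝ) ^ θ ≤ Y ^ (1 - θ) := by
    have := Real.rpow_le_rpow (by positivity) hY hθ'.le
    rwa [← Real.rpow_mul hq.le, div_mul_cancel₀ _ hθ'.ne'] at this
  have hn' : x.1 * n ≤ r.den * Y := by
    have : ((r.den : ℤ) : ℝ) / (x.1 * X) = r.den * Y / x.1 := by
      rw [hYdef]; push_cast; field_simp
    rw [this, le_div_iff₀ ha] at hn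
    linarith
  calc x.1 ^ θ / 4 * (n : ℝ) ^ θ = (x.1 * n) ^ θ / 4 := by
        rw [Real.mul_rpow ha.le n.cast_nonneg]; ring
    _ ≤ (r.den * Y) ^ θ / 4 := by gcongr
    _ = (r.den : ℝ) ^ θ * Y ^ θ / 4 := by rw [Real.mul_rpow hq.le hY0.le]
    _ ≤ Y ^ (1 - θ) * Y ^ θ / 4 := by gcongr
    _ = Y / 4 := by rw [mul_comm (Y ^ (1 - θ)), rpow_mul_rpow_one_sub hY0]

theorem partialSum_large_of_even {θ : ℝ} (hθ : 0 < θ) (hθ1 : θ < 1)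
    (hinf : {r : ℚ | 0 < r - x.2 / x.1 ∧
      r - x.2 / x.1 < 1 / (r.den : ℝ) ^ (2 / (1 - θ))}.Infinite) :
    ∃ c : ℝ, 0 < c ∧ ∀ H : ℝ, ∃ n : ℕ, H ≤ |(partialSum x n : ℝ)| ∧
      c * (n : ℝ) ^ θ ≤ |(partialSum x n : ℝ)| := by
  have ha := hx.1.1
  have ha1 := hx.1.2
  have hθ' : 0 < 1 - θ := by linarith
  refine ⟨1 / (16 * (8 / x.1 ^ 2) ^ θ), by positivity, fun H => ?_⟩
  obtain ⟨D, hD⟩ := exists_natCast_rpow_ge (p := 2 * θ / (1 - θ)) (by positivity)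
    (max 16 (16 * H))
  obtain ⟨r, ⟨h1, h2⟩, hr⟩ := exists_den_gt (s := x.2 / x.1) hinf (fun r hr => by
    rw [abs_sub_comm, abs_of_pos hr.1]
    refine hr.2.le.trans ?_
    have : (1 : ℝ) ≤ r.den := by exact_mod_cast r.den_pos
    rw [div_le_one (by positivity)]
    exact Real.one_le_rpow this (by positivity)) D
  have hq : (0 : ℝ) < r.den := by exact_mod_cast r.den_pos
  have hε : 0 < -width x (r.den, r.num) := by
    rw [width_den_num ha, ← mul_neg, neg_sub]; positivity
  have hεlt : -width x (r.den, r.num) * r.den * (r.den : ℝ) ^ (2 * θ / (1 - θ)) ≤ x.1 := by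
    rw [width_den_num ha, ← mul_neg, neg_sub]
    rw [lt_div_iff₀ (by positivity)] at h2
    have e : (r.den : ℝ) ^ (2 / (1 - θ)) = r.den * r.den * (r.den : ℝ) ^ (2 * θ / (1 - θ)) := by
      rw [show 2 / (1 - θ) = 1 + 1 + 2 * θ / (1 - θ) by field_simp; ring, Real.rpow_add hq,
        Real.rpow_add hq, Real.rpow_one]
    rw [e] at h2
    nlinarith
  have hbig := hD r.den hr.le
  have h16 := (le_max_left _ _).trans hbig
  have hH := (le_max_right _ _).trans hbig
  -- The largest real m allowed in `exists_partialSum_large_of_neg_width`; its floor is used.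
  set W := x.1 / (4 * (-width x (r.den, r.num)) * r.den) with hW
  have hden : 0 < 4 * (-width x (r.den, r.num)) * r.den := by positivity
  have hWge : (r.den : ℝ) ^ (2 * θ / (1 - θ)) ≤ 4 * W := by
    rw [hW, mul_div_assoc', le_div_iff₀ hden]; linarith
  have hW4 : 4 ≤ W := by linarith
  have hfl := Nat.floor_le (by linarith : 0 ≤ W)
  have hfl' := Nat.lt_floor_add_one W
  have hmW : (⌊W⌋₊ : ℝ) * (4 * (-width x (r.den, r.num)) * r.den) ≤ x.1 := by
    rwa [hW, le_div_iff₀ hden] at hfl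
  have hWe : W * (4 * (-width x (r.den, r.num)) * r.den) = x.1 := div_mul_cancel₀ _ hden.ne'
  obtain ⟨n, hn, hf⟩ := exists_partialSum_large_of_neg_width hx (w := (r.den, r.num))
    (isCoprime_den_num r) (by simpa using r.den_pos) (neg_pos.1 hε)
    (by push_cast; nlinarith) (m := ⌊W⌋₊) (Nat.floor_pos.2 (by linarith))
    (by push_cast; linarith)
  have hfW : W / 4 ≤ |(partialSum x n : ℝ)| := by linarith
  refine ⟨n, by linarith, le_trans ?_ hfW⟩
  have hW0 : 0 < W := by linarith
  have hqW : (r.den : ℝ) ^ θ * (r.den : ℝ) ^ θ ≤ 4 * W ^ (1 - θ) := by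
    have := Real.rpow_le_rpow (by positivity) hWge hθ'.le
    rw [← Real.rpow_mul hq.le, div_mul_cancel₀ _ hθ'.ne', two_mul, Real.rpow_add hq,
      Real.mul_rpow (by norm_num) hW0.le] at this
    refine this.trans ?_
    gcongr
    calc (4 : ℝ) ^ (1 - θ) ≤ 4 ^ (1 : ℝ) := by gcongr <;> linarith
      _ = 4 := Real.rpow_one 4
  have hn' : (n : ℝ) ≤ 8 / x.1 ^ 2 * (r.den * r.den * W) := by
    refine hn.trans ?_
    push_cast
    calc 4 / x.1 ^ 2 * (r.den : ℝ) ^ 2 * (⌊W⌋₊ + 1) ≤ 4 / x.1 ^ 2 * (r.den : ℝ) ^ 2 * (2 * W) := by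
          gcongr; linarith
      _ = _ := by ring
  calc 1 / (16 * (8 / x.1 ^ 2) ^ θ) * (n : ℝ) ^ θ
      ≤ 1 / (16 * (8 / x.1 ^ 2) ^ θ) * (8 / x.1 ^ 2 * (r.den * r.den * W)) ^ θ := by gcongr
    _ = (r.den : ℝ) ^ θ * (r.den : ℝ) ^ θ * W ^ θ / 16 := by
      rw [Real.mul_rpow (by positivity) (by positivity), Real.mul_rpow (by positivity) hW0.le,
        Real.mul_rpow hq.le hq.le]
      field_simp
    _ ≤ 4 * W ^ (1 - θ) * W ^ θ / 16 := by gcongr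
    _ = 4 * (W ^ θ * W ^ (1 - θ)) / 16 := by ring
    _ = W / 4 := by rw [rpow_mul_rpow_one_sub hW0]; ring

end Frequent

/-! ### Passage to logarithmic speed -/

theorem frequently_le_logSpeed {f : ℕ → ℤ} {θ θ' c : ℝ} (hθ : θ' < θ) (hc : 0 < c)
    (h : ∀ H : ℝ, ∃ n : ℕ, H ≤ |(f n : ℝ)| ∧ c * (n : ℝ) ^ θ ≤ |(f n : ℝ)|) :
    ∃ᶠ n in atTop, (θ' : EReal) ≤ logSpeed (f n) n := by
  obtain ⟨D, hD⟩ := exists_natCast_rpow_ge (p := θ - θ') (by linarith) (1 / c)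
  rw [frequently_atTop]
  intro N
  -- A threshold above every earlier value of |f| forces n to be large.
  obtain ⟨n, h1, h2⟩ := h (∑ i ∈ Finset.range (max N (max D 2)), |(f i : ℝ)| + 1)
  have hn : max N (max D 2) ≤ n := by
    by_contra! hlt
    have := Finset.single_le_sum (f := fun i => |(f i : ℝ)|) (fun i _ => abs_nonneg _)
      (Finset.mem_range.2 hlt)
    linarith
  have hnN := (le_max_left _ _).trans hn
  have hnD := ((le_max_left _ _).trans (le_max_right _ _)).trans hn
  have hn2 := ((le_max_right D 2).trans (le_max_right _ _)).trans hn
  refine ⟨n, hnN, ?_⟩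
  have hf : 0 < |(f n : ℝ)| := lt_of_lt_of_le (by positivity) h1
  have hf0 : f n ≠ 0 := by
    rintro h0
    simp [h0] at hf
  have hn2' : (2 : ℝ) ≤ n := by exact_mod_cast hn2
  have hn0 : (0 : ℝ) < n := by linarith
  have hlog : 0 < Real.log n := Real.log_pos (by linarith)
  rw [logSpeed, if_neg hf0, EReal.coe_le_coe_iff, le_div_iff₀ hlog, ← Real.log_rpow hn0]
  refine Real.log_le_log (by positivity) (le_trans ?_ h2)
  have h3 := hD n hnD
  rw [div_le_iff₀ hc] at h3
  have h4 : (n : ℝ) ^ θ = (n : ℝ) ^ (θ - θ') * (n : ℝ) ^ θ' := by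
    rw [← Real.rpow_add hn0]; congr 1; ring
  rw [h4]
  have : 0 < (n : ℝ) ^ θ' := by positivity
  nlinarith

theorem eventually_logSpeed_le {f : ℕ → ℤ} {θ θ' C : ℝ} (hθ : θ < θ') (hC : 0 < C)
    (h : ∀ n : ℕ, 1 ≤ n → |(f n : ℝ)| ≤ C * (n : ℝ) ^ θ * (1 + Real.log n)) :
    ∀ᶠ n in atTop, logSpeed (f n) n ≤ (θ' : EReal) := by
  have hp : 0 < θ' - θ := by linarith
  have h1 : (fun y : ℝ => C * (1 + Real.log y)) =o[atTop] fun y => y ^ (θ' - θ) := by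
    refine Asymptotics.IsLittleO.const_mul_left ?_ C
    refine Asymptotics.IsLittleO.add ?_ (isLittleO_log_rpow_atTop hp)
    exact Asymptotics.isLittleO_const_left.2
      (Or.inr (tendsto_norm_atTop_atTop.comp (tendsto_rpow_atTop hp)))
  have h2 := tendsto_natCast_atTop_atTop (R := ℝ) |>.eventually (h1.bound one_pos)
  filter_upwards [h2, eventually_ge_atTop 2] with n hn hn2
  by_cases hf0 : f n = 0
  · rw [logSpeed, if_pos hf0]; exact bot_le
  have hn2' : (2 : ℝ) ≤ n := by exact_mod_cast hn2
  have hn0 : (0 : ℝ) < n := by linarith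
  have hlog : 0 < Real.log n := Real.log_pos (by linarith)
  have hf : 0 < |(f n : ℝ)| := abs_pos.2 (by exact_mod_cast hf0)
  rw [logSpeed, if_neg hf0, EReal.coe_le_coe_iff, div_le_iff₀ hlog, ← Real.log_rpow hn0]
  refine Real.log_le_log hf ((h n (by omega)).trans ?_)
  rw [Real.norm_of_nonneg (by positivity), Real.norm_of_nonneg (by positivity), one_mul] at hn
  calc C * (n : ℝ) ^ θ * (1 + Real.log n) = C * (1 + Real.log n) * (n : ℝ) ^ θ := by ring
    _ ≤ (n : ℝ) ^ (θ' - θ) * (n : ℝ) ^ θ := by gcongr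
    _ = (n : ℝ) ^ θ' := by rw [← Real.rpow_add hn0]; congr 1; ring

/-! ### Arithmetic of the ratio (e - c) / e for e ≥ 2 -/

section Ratio

variable {e : EReal} {c θ : ℝ} (he : ((2 : ℝ) : EReal) ≤ e)
include he

theorem exponentRatio_cases : e = ⊤ ∧ exponentRatio c e = (1 : ℝ) ∨
    ∃ y : ℝ, 2 ≤ y ∧ e = y ∧ exponentRatio c e = ((y - c) / y : ℝ) := by
  induction e using EReal.rec with
  | bot => simp at he
  | top => left; simp [exponentRatio]
  | coe y =>
    right
    refine ⟨y, EReal.coe_le_coe_iff.1 he, rfl, ?_⟩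
    rw [exponentRatio, if_neg (EReal.coe_ne_top y), EReal.coe_div, EReal.coe_sub]

theorem lt_of_lt_exponentRatio (hθ : θ < 1) (h : (θ : EReal) < exponentRatio c e) :
    ((c / (1 - θ) : ℝ) : EReal) < e := by
  rcases exponentRatio_cases (c := c) he with ⟨rfl, -⟩ | ⟨y, hy, rfl, hr⟩
  · exact EReal.coe_lt_top _
  · rw [hr, EReal.coe_lt_coe_iff, lt_div_iff₀ (by linarith)] at h
    rw [EReal.coe_lt_coe_iff, div_lt_iff₀ (by linarith)]
    linarith

theorem lt_of_exponentRatio_lt (hθ : θ < 1) (h : exponentRatio c e < (θ : EReal)) :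
    e < ((c / (1 - θ) : ℝ) : EReal) := by
  rcases exponentRatio_cases (c := c) he with ⟨rfl, hr⟩ | ⟨y, hy, rfl, hr⟩
  · rw [hr, EReal.coe_lt_coe_iff] at h
    linarith
  · rw [hr, EReal.coe_lt_coe_iff, div_lt_iff₀ (by linarith)] at h
    rw [EReal.coe_lt_coe_iff, lt_div_iff₀ (by linarith)]
    linarith

theorem exponentRatio_le_one (hc : 0 ≤ c) : exponentRatio c e ≤ (1 : ℝ) := by
  rcases exponentRatio_cases (c := c) he with ⟨-, hr⟩ | ⟨y, hy, -, hr⟩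
  · rw [hr]
  · rw [hr, EReal.coe_le_coe_iff, div_le_one (by linarith)]
    linarith

theorem exponentRatio_one_pos : ((0 : ℝ) : EReal) < exponentRatio 1 e := by
  rcases exponentRatio_cases (c := 1) he with ⟨-, hr⟩ | ⟨y, hy, -, hr⟩
  · rw [hr, EReal.coe_lt_coe_iff]; exact one_pos
  · rw [hr, EReal.coe_lt_coe_iff]
    exact div_pos (by linarith) (by linarith)

end Ratio

end BCZ

/-! ### The two inequalities for the limsup -/

theorem theorem1p2 (a b : ℝ) (hab : (a, b) ∈ BCZ.fareyTriangle) (hirr : Irrational (b / a)) :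
    limsup (fun n : ℕ => BCZ.logSpeed (BCZ.partialSum (a, b) n) n) atTop
      = max (BCZ.exponentRatio 1 (BCZ.oddExponent (b / a)))
          (BCZ.exponentRatio 2 (BCZ.evenExponent (b / a))) := by
  have ha : 0 < a := hab.1.1
  have hodd : ((2 : ℝ) : EReal) ≤ BCZ.oddExponent (b / a) :=
    BCZ.le_approxExponent (v := 2) (BCZ.infinite_lower_approx hirr)
  have heven : ((2 : ℝ) : EReal) ≤ BCZ.evenExponent (b / a) :=
    BCZ.le_approxExponent (v := 2) (BCZ.infinite_upper_approx hirr)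
  have hne : ∀ z : ℤ × ℤ, 0 < z.1 → BCZ.width (a, b) z ≠ 0 := by
    intro z hz h
    refine hirr ⟨z.2 / z.1, ?_⟩
    have hz' : (0 : ℝ) < z.1 := by exact_mod_cast hz
    simp only [BCZ.width] at h
    push_cast
    rw [div_eq_div_iff hz'.ne' ha.ne']
    linarith
  refine le_antisymm (le_of_forall_gt_imp_ge_of_dense fun y hy => ?_)
    (le_of_forall_lt_imp_le_of_dense fun y hy => ?_)
  · obtain ⟨θ', h1, h2⟩ := EReal.lt_iff_exists_real_btwn.1 hy
    obtain ⟨θ, h3, h4⟩ := EReal.lt_iff_exists_real_btwn.1 h1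
    have hpos : 0 < θ := EReal.coe_lt_coe_iff.1
      (((BCZ.exponentRatio_one_pos hodd).trans_le (le_max_left _ _)).trans h3)
    rw [EReal.coe_lt_coe_iff] at h4
    refine le_trans ?_ h2.le
    obtain ⟨ϑ, c, hϑ0, hϑ1, hϑθ, hc, hO, hE⟩ : ∃ ϑ c : ℝ, 0 < ϑ ∧ ϑ ≤ 1 ∧ ϑ ≤ θ ∧ 0 < c ∧
        BCZ.OddBound (a, b) ϑ c ∧ BCZ.EvenBound (a, b) ϑ c := by
      rcases lt_or_ge θ 1 with hlt | hge
      · obtain ⟨c₁, hc₁, hO⟩ := BCZ.oddBound_of_exponent_lt (x := (a, b)) ha hlt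
          (BCZ.lt_of_exponentRatio_lt hodd hlt ((le_max_left _ _).trans_lt h3))
        obtain ⟨c₂, hc₂, hE⟩ := BCZ.evenBound_of_exponent_lt (x := (a, b)) ha hlt
          (BCZ.lt_of_exponentRatio_lt heven hlt ((le_max_right _ _).trans_lt h3))
        exact ⟨θ, min c₁ c₂, hpos, hlt.le, le_rfl, lt_min hc₁ hc₂, hO.mono (min_le_left _ _),
          hE.mono (min_le_right _ _)⟩
      -- For θ ≥ 1 the trivial bounds with exponent 1 suffice, which covers infinite exponents.
      · exact ⟨1, 1, one_pos, le_rfl, hge, one_pos, BCZ.oddBound_one _, BCZ.evenBound_one _⟩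
    obtain ⟨C, hC, hbound⟩ := BCZ.exists_abs_partialSum_le hab hne hϑ0 hϑ1 hc hO hE
    exact limsup_le_of_le (by isBoundedDefault)
      (BCZ.eventually_logSpeed_le (hϑθ.trans_lt h4) hC hbound)
  · have hmax := (BCZ.exponentRatio_one_pos hodd).trans_le
      (le_max_left _ (BCZ.exponentRatio 2 (BCZ.evenExponent (b / a))))
    -- The maximum is positive because the odd exponent is at least 2, so θ' can be taken positive
    -- even when y is not.
    obtain ⟨θ', h1, h2⟩ := EReal.lt_iff_exists_real_btwn.1 (max_lt hy hmax)
    obtain ⟨θ, h3, h4⟩ := EReal.lt_iff_exists_real_btwn.1 h2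
    have hpos : 0 < θ' := EReal.coe_lt_coe_iff.1 ((le_max_right _ _).trans_lt h1)
    rw [EReal.coe_lt_coe_iff] at h3
    have hθ1 : θ < 1 := EReal.coe_lt_coe_iff.1 (h4.trans_le (max_le
      (BCZ.exponentRatio_le_one hodd zero_le_one) (BCZ.exponentRatio_le_one heven zero_le_two)))
    refine ((le_max_left _ _).trans h1.le).trans ?_
    have hlarge : ∃ c : ℝ, 0 < c ∧ ∀ H : ℝ, ∃ n : ℕ,
        H ≤ |(BCZ.partialSum (a, b) n : ℝ)| ∧
          c * (n : ℝ) ^ θ ≤ |(BCZ.partialSum (a, b) n : ℝ)| := by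
      rcases lt_max_iff.1 h4 with h | h
      · exact BCZ.partialSum_large_of_odd hab (hpos.trans h3) hθ1
          (BCZ.infinite_of_lt_approxExponent (BCZ.lt_of_lt_exponentRatio hodd hθ1 h))
      · exact BCZ.partialSum_large_of_even hab (hpos.trans h3) hθ1
          (BCZ.infinite_of_lt_approxExponent (BCZ.lt_of_lt_exponentRatio heven hθ1 h))
    obtain ⟨c, hc, hlarge⟩ := hlarge
    exact le_limsup_of_frequently_le (BCZ.frequently_le_logSpeed h3 hc hlarge)
      (by isBoundedDefault)
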